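/- Setting. Let $d,N\ge 0$ and let $D_1,\dots,D_N\subset\mathbb R^d$ be bounded, open, connected sets, each containing the origin, such that for $i\ne j$ the set $D_j$ is not the image of $D_i$ under a map $\xi\mapsto R\xi+y$ with $R\in SO(d)$, $y\in\mathbb R^d$. Let $(\Omega,\mathcal F,\mathbf P)$ be a probability space carrying a jointly measurable, measure preserving, ergodic action $(x,\omega)\mapsto\tau_x\omega$ of the group $\mathbb R^d$. Let $G^\omega\subset\mathbb R^d$, $\omega\in\Omega$, be a random set with $G^{\tau_x\omega}=G^\omega-x$ for all $x,\omega$, such that almost surely every connected component of $G^\omega$ is of the form $R D_j+y$ for some $j$, $R\in SO(d)$, $y\in\mathbb R^d$. Let $\mathcal G^\omega_j$ be the union of the components of $G^\omega$ that are of this form with the given $j$; the events $\{0\in G^\omega\}$ and $\{0\in\mathcal G^\omega_j\}$ are assumed measurable. (Disperse media with connected unbounded complement, uniformly separated inclusions and $C^2$ reference domains are a special case; these extra conditions are not needed.) Put $$\alpha_0=\mathbf P\{0\notin G^\omega\},\qquad \alpha_j=|D_j|^{-1}\,\mathbf P\{0\in\mathcal G^\omega_j\},\quad j=1,\dots,N,$$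 and assume $\alpha_0>0$ and $\alpha_j>0$ for all $j$. Let $L^2(E,\alpha)$, where $E=\mathbb R^d\times(\{\star\}\sqcup D_1\sqcup\dots\sqcup D_N)$, be the real Hilbert space of (classes of) functions $F=(f_0,f_1,\dots,f_N)$, $f_0=F(\cdot,\star)\in L^2(\mathbb R^d)$, $f_j\in L^2(\mathbb R^d\times D_j)$, with norm $$\|F\|^2_{L^2(E,\alpha)}=\alpha_0\int_{\mathbb R^d}f_0^2(x)\,dx+\sum_{j=1}^N\alpha_j\int_{\mathbb R^d}\int_{D_j}f_j^2(x,\xi)\,d\xi\,dx .$$ Write the components of $\mathcal G^\omega_j$ as $\mathcal G^{\omega,i}_j=R^{\omega,i}_jD_j+y^{\omega,i}_j$ (any choice of such $R\in SO(d)$ and $y$), and for $\varepsilon\in(0,1)$ put $\hat x^{\omega,i}_j=\varepsilon y^{\omega,i}_j$ and $$(\pi^\omega_\varepsilon F)(x)=\begin{cases} f_0(x), & x\in\mathbb R^d\setminus\varepsilon G^\omega,\\[1mm] \hat f_j\Big(\hat x^{\omega,i}_j,\,(R^{\omega,i}_j)^{-1}\dfrac{x-\hat x^{\omega,i}_j}{\varepsilon}\Big),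 & x\in\varepsilon\mathcal G^{\omega,i}_j,\end{cases}$$ $$\hat f_j(\hat x^{\omega,i}_j,\xi)=\frac1{\varepsilon^d|D_j|}\int_{\varepsilon R^{\omega,i}_jD_j}f_j(\hat x^{\omega,i}_j+\eta,\xi)\,d\eta .$$ Claim. Almost surely, for every $\varepsilon\in(0,1)$ this formula defines a bounded linear operator $\pi^\omega_\varepsilon:L^2(E,\alpha)\to L^2(\mathbb R^d)$ (up to null sets, the result does not depend on the representative of $F$), and there is a deterministic constant $C$, independent of $\varepsilon$ and $F$, such that almost surely $$\|\pi^\omega_\varepsilon F\|_{L^2(\mathbb R^d)}\le C\,\|F\|_{L^2(E,\alpha)}\qquad\text{for all }\varepsilon\in(0,1)\text{ and all }F\in L^2(E,\alpha).$$ Moreover, for each $F\in L^2(E,\alpha)$, almost surely $$\|\pi^\omega_\varepsilon F\|^2_{L^2(\mathbb R^d)}\to\|F\|^2_{L^2(E,\alpha)}\qquad\text{as }\varepsilon\to0^+ .$$ -/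

import Mathlib

open MeasureTheory Set Filter Topology
open scoped ENNReal Pointwise

noncomputable section

namespace HighContrast

/-- The space `ℝ^d` with its Euclidean structure and Lebesgue measure. -/
abbrev Space (d : ℕ) : Type := EuclideanSpace ℝ (Fin d)

/-- An orientation preserving rigid motion `ξ ↦ R ξ + y` of `ℝ^d`, with `R ∈ SO(d)`. -/
structure RigidMotion (d : ℕ) where
  rot : Space d ≃ₗᵢ[ℝ] Space d
  det_rot : LinearMap.det (rot.toLinearEquiv : Space d →ₗ[ℝ] Space d) = 1
  trans : Space d

/-- The image `R D + y` of a set `D` under a rigid motion. -/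
def RigidMotion.image {d : ℕ} (m : RigidMotion d) (D : Set (Space d)) : Set (Space d) :=
  (fun ξ => m.rot ξ + m.trans) '' D

/-- `C` is obtained from `D` by a rotation and a translation. -/
def IsRigidCopy {d : ℕ} (D C : Set (Space d)) : Prop :=
  ∃ m : RigidMotion d, m.image D = C

/-- The union of those connected components of the set `G` that are rigid copies of `D`. -/
def copiesIn {d : ℕ} (G D : Set (Space d)) : Set (Space d) :=
  {x | x ∈ G ∧ IsRigidCopy D (connectedComponentIn G x)}

/-- A statistically homogeneous random set `G^ω ⊂ ℝ^d` on a probability space on which `ℝ^d` acts,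
all of whose connected components are, almost surely, rigid copies of the finitely many bounded
reference domains `D_1, …, D_N`.  The reference domains contain the origin and no two of
them have the same shape.  This covers the disperse media with connected unbounded complement,
uniformly separated inclusions and `C²` reference domains: none of these extra conditions is
imposed. -/
structure IsInclusionMedium {d N : ℕ} {Ω : Type*} [MeasurableSpace Ω] [AddAction (Space d) Ω]
    (P : Measure Ω) (D : Fin N → Set (Space d)) (G : Ω → Set (Space d)) : Prop where
  isOpen_domain : ∀ j, IsOpen (D j)
  isConnected_domain : ∀ j, IsConnected (D j)
  isBounded_domain : ∀ j, Bornology.IsBounded (D j)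
  zero_mem_domain : ∀ j, (0 : Space d) ∈ D j
  distinct_domains : ∀ i j, i ≠ j → ¬ IsRigidCopy (D i) (D j)
  homogeneous : ∀ (x : Space d) (ω : Ω), G (x +ᵥ ω) = {z | z + x ∈ G ω}
  measurable_medium : MeasurableSet {ω | (0 : Space d) ∈ G ω}
  measurable_copies : ∀ j, MeasurableSet {ω | (0 : Space d) ∈ copiesIn (G ω) (D j)}
  components : ∀ᵐ ω ∂P, ∀ x ∈ G ω, ∃ j, IsRigidCopy (D j) (connectedComponentIn (G ω) x)

/-- `α_0 = P {0 ∉ G^ω}`. -/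
def alphaZero {d : ℕ} {Ω : Type*} [MeasurableSpace Ω] (P : Measure Ω) (G : Ω → Set (Space d)) :
    ℝ≥0∞ :=
  P {ω | (0 : Space d) ∉ G ω}

/-- `α_j = |D_j|⁻¹ P {0 ∈ 𝒢_j^ω}`. -/
def alpha {d N : ℕ} {Ω : Type*} [MeasurableSpace Ω] (P : Measure Ω)
    (D : Fin N → Set (Space d)) (G : Ω → Set (Space d)) (j : Fin N) : ℝ≥0∞ :=
  (volume (D j))⁻¹ * P {ω | (0 : Space d) ∈ copiesIn (G ω) (D j)}

/-- Points of `{⋆} ∪ D_1 ∪ … ∪ D_N` (disjoint union): `Sum.inl ()` is `⋆`, and `Sum.inr (j, ξ)` is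
the point `ξ` of the `j`-th domain.  The points with `ξ ∉ D_j` carry no mass below. -/
abbrev Fibre (d N : ℕ) : Type := Unit ⊕ (Fin N × Space d)

/-- The measure with mass `α_0` at `⋆` and density `α_j` on `D_j`. -/
def fibreMeasure {d N : ℕ} {Ω : Type*} [MeasurableSpace Ω] (P : Measure Ω)
    (D : Fin N → Set (Space d)) (G : Ω → Set (Space d)) : Measure (Fibre d N) :=
  alphaZero P G • Measure.dirac (Sum.inl ()) +
    ∑ j, alpha P D G j • (volume.restrict (D j)).map (fun ξ => Sum.inr (j, ξ))

/-- The measure on `E = ℝ^d × ({⋆} ∪ D_1 ∪ … ∪ D_N)` for which `∫ |F|²` equals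
`α_0 ∫ f_0(x)² dx + ∑_j α_j ∫∫_{ℝ^d × D_j} f_j(x, ξ)² dξ dx`. -/
def measureE {d N : ℕ} {Ω : Type*} [MeasurableSpace Ω] (P : Measure Ω)
    (D : Fin N → Set (Space d)) (G : Ω → Set (Space d)) : Measure (Space d × Fibre d N) :=
  (volume : Measure (Space d)).prod (fibreMeasure P D G)

/-- The real Hilbert space `L²(E, α)`. -/
abbrev L2E {d N : ℕ} {Ω : Type*} [MeasurableSpace Ω] (P : Measure Ω)
    (D : Fin N → Set (Space d)) (G : Ω → Set (Space d)) : Type :=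
  Lp ℝ 2 (measureE P D G)

/-- The real Hilbert space `L²(ℝ^d)`. -/
abbrev L2 (d : ℕ) : Type := Lp ℝ 2 (volume : Measure (Space d))

/-- A choice, for every inclusion `C` of the medium, of a rigid motion that maps the reference
domain of the same shape onto `C`. -/
def IsPlacement {d N : ℕ} {Ω : Type*} [MeasurableSpace Ω] (P : Measure Ω)
    (D : Fin N → Set (Space d)) (G : Ω → Set (Space d))
    (place : Ω → Set (Space d) → RigidMotion d) : Prop :=
  ∀ᵐ ω ∂P, ∀ j, ∀ x ∈ copiesIn (G ω) (D j),
    (place ω (connectedComponentIn (G ω) x)).image (D j) = connectedComponentIn (G ω) x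

/-- The mean of `f(·, ξ)` over the scaled inclusion `ε (R D + y) = x̂ + ε R D`, `x̂ = ε y`:
`(ε^d |D|)⁻¹ ∫_{ε R D} f(x̂ + η, ξ) dη`. -/
def cellMean {d : ℕ} (ε : ℝ) (D : Set (Space d)) (m : RigidMotion d)
    (f : Space d → Space d → ℝ) (ξ : Space d) : ℝ :=
  (ε ^ d * (volume D).toReal)⁻¹ * ∫ η in ε • (m.rot '' D), f (ε • m.trans + η) ξ

open Classical in
/-- The function `π_ε F` for a single realization `G` of the medium: it equals `F(x, ⋆)` for
`x ∉ ε G`; on the scaled inclusion `ε (R D_j + y)` it equals `f̂_j(x̂, R⁻¹ (x - x̂) / ε)`, where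
`x̂ = ε y` and `f̂_j(x̂, ξ)` is the mean of `F(·, j, ξ)` over that scaled inclusion. -/
def piFun {d N : ℕ} (D : Fin N → Set (Space d)) (G : Set (Space d))
    (place : Set (Space d) → RigidMotion d) (ε : ℝ) (F : Space d × Fibre d N → ℝ)
    (x : Space d) : ℝ :=
  if ε⁻¹ • x ∈ G then
    ∑ j, if ε⁻¹ • x ∈ copiesIn G (D j) then
      let m := place (connectedComponentIn G (ε⁻¹ • x))
      cellMean ε (D j) m (fun y ξ => F (y, Sum.inr (j, ξ)))
        (m.rot.symm (ε⁻¹ • (x - ε • m.trans)))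
    else 0
  else F (x, Sum.inl ())

end HighContrast

end

open HighContrast

/-! On a scaled inclusion `ε C`, with `C = R D_j + y`, the function `π_ε F` is the mean of `f_j(·,
ξ)` over `ε C`, evaluated at the point `ξ ∈ D_j` corresponding to `x`. Changing variables from `ε C`
to `D_j` turns its energy there into `|D_j|⁻¹ ∫_{εC} ∫_{D_j} |mean|²`, and Jensen's inequality
bounds this by `|D_j|⁻¹ ∫_{εC} ∫_{D_j} f_j²`. The inclusions are disjoint, so summation gives a
bound with the deterministic constant `C² = α_0⁻¹ + ∑_j |D_j|⁻¹ α_j⁻¹`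
(`lintegral_piFun_le_boundSq`).

Because this bound is uniform in `ε`, convergence of norms need only be proved on a dense set
(`tendsto_norm_of_forall_near`). For continuous compactly supported `F` the inclusions have diameter
`O(ε)`, so uniform continuity allows the means to be replaced by values
(`eventually_lintegral_piFun_near`). What remains are integrals of fixed integrable functions over
`ε 𝒢_j` and over the complement of `ε G`. By homogeneity these are rescaled visit sets of the orbit
of `ω`, and the ergodic theorem replaces their indicators by `P{0 ∈ 𝒢_j} = |D_j| α_j` and by `α_0`.

The ergodic theorem for `ℝ^d` (`ae_tendsto_orbitIntegral`) combines a maximal inequality,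
transferred from Vitali's covering lemma along orbits, with the splitting of `L²(P)` into constants
and the closure of a space of observables with vanishing averages, among them the bounded
coboundaries. -/

namespace HighContrast

/-! ### Maximal inequality for measure preserving actions of `ℝ^d`. -/

section MaximalInequality

open Metric

lemma volume_ball_of_pos {d : ℕ} (x : Space d) {r : ℝ} (hr : 0 < r) :
    volume (ball x r) = ENNReal.ofReal (r ^ d) * volume (ball (0 : Space d) 1) := by
  simpa using Measure.addHaar_ball_of_pos (volume : Measure (Space d)) x hr

lemma volume_ball_ne_zero {d : ℕ} (x : Space d) {r : ℝ} (hr : 0 < r) : volume (ball x r) ≠ 0 :=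
  (measure_ball_pos volume x hr).ne'

/-- The Vitali covering bound behind the maximal inequality. -/
lemma mul_volume_le_of_forall_ball {d : ℕ} (g : Space d → ℝ≥0∞) (lam : ℝ≥0∞) {R : ℝ}
    {S : Set (Space d)} (hS : S ⊆ ball 0 R)
    (h : ∀ x ∈ S, ∃ r, 0 < r ∧ r ≤ R ∧ lam * volume (ball x r) ≤ ∫⁻ y in ball x r, g y) :
    lam * volume S ≤ ENNReal.ofReal (5 ^ d) * ∫⁻ y in ball 0 (2 * R), g y := by
  choose! r hr0 hrR hr using h
  obtain ⟨u, huS, hud, hu⟩ := Vitali.exists_disjoint_subfamily_covering_enlargement_ball S id r R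
    hrR 5 (by norm_num)
  have hc : u.Countable := hud.countable_of_isOpen (fun _ _ => isOpen_ball)
    (fun i hi => ⟨i, mem_ball_self (hr0 i (huS hi))⟩)
  -- The selected disjoint balls, enlarged five times, cover `S`; the volume ratio is the constant
  -- `5 ^ d`.
  have hcov : S ⊆ ⋃ b ∈ u, ball b (5 * r b) := fun x hx => by
    obtain ⟨b, hb, hsub⟩ := hu x hx
    exact mem_biUnion hb (hsub (mem_ball_self (hr0 x hx)))
  have hsub : ⋃ b ∈ u, ball b (r b) ⊆ ball 0 (2 * R) := iUnion₂_subset fun b hb => by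
    refine ball_subset_ball' ?_
    have h1 := mem_ball.1 (hS (huS hb))
    have h2 := hrR b (huS hb)
    linarith
  calc lam * volume S ≤ lam * ∑' b : u, volume (ball (b : Space d) (5 * r b)) := by
        gcongr
        exact (measure_mono hcov).trans (measure_biUnion_le _ hc _)
    _ = ∑' b : u, ENNReal.ofReal (5 ^ d) * (lam * volume (ball (b : Space d) (r b))) := by
        rw [← ENNReal.tsum_mul_left]
        congr 1 with b
        have hb := hr0 b (huS b.2)
        rw [volume_ball_of_pos _ (by positivity), volume_ball_of_pos _ hb, mul_pow,
          ENNReal.ofReal_mul (by positivity)]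
        ring
    _ ≤ ∑' b : u, ENNReal.ofReal (5 ^ d) * ∫⁻ y in ball (b : Space d) (r b), g y := by
        gcongr with b
        exact hr b (huS b.2)
    _ = ENNReal.ofReal (5 ^ d) * ∫⁻ y in ⋃ b ∈ u, ball b (r b), g y := by
        rw [ENNReal.tsum_mul_left, lintegral_biUnion (s := fun b => ball b (r b)) hc
          (fun _ _ => measurableSet_ball) hud]
    _ ≤ _ := by
        gcongr

variable {d : ℕ} {Ω : Type*} [MeasurableSpace Ω] [AddAction (Space d) Ω]

/-- The set where the maximal function of `f` over balls of radius `1, …, R` exceeds `lam`. -/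
def maximalSet (d : ℕ) {Ω : Type*} [AddAction (Space d) Ω] (f : Ω → ℝ≥0∞) (lam : ℝ≥0∞) (R : ℕ) :
    Set Ω :=
  {ω | ∃ n : ℕ, 0 < n ∧ n ≤ R ∧
    lam * volume (ball (0 : Space d) n) < ∫⁻ x in ball (0 : Space d) n, f (x +ᵥ ω)}

variable [MeasurableVAdd₂ (Space d) Ω]

lemma measurable_lintegral_vadd {f : Ω → ℝ≥0∞} (hf : Measurable f) (s : Set (Space d)) :
    Measurable fun ω => ∫⁻ x in s, f (x +ᵥ ω) :=
  Measurable.lintegral_prod_right' (f := fun p : Ω × Space d => f (p.2 +ᵥ p.1))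
    (hf.comp (measurable_snd.vadd measurable_fst))

lemma measurableSet_maximalSet {f : Ω → ℝ≥0∞} (hf : Measurable f) (lam : ℝ≥0∞) (R : ℕ) :
    MeasurableSet (maximalSet d f lam R) := by
  have : maximalSet d f lam R = ⋃ n ∈ {n : ℕ | 0 < n ∧ n ≤ R},
      {ω | lam * volume (ball (0 : Space d) n) < ∫⁻ x in ball (0 : Space d) n, f (x +ᵥ ω)} := by
    ext ω; simp [maximalSet, and_assoc]
  rw [this]
  exact MeasurableSet.biUnion (to_countable _) fun n _ =>
    measurableSet_lt measurable_const (measurable_lintegral_vadd hf _)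

lemma lintegral_lintegral_vadd (P : Measure Ω) [SFinite P] [VAddInvariantMeasure (Space d) Ω P]
    {f : Ω → ℝ≥0∞} (hf : Measurable f) (s : Set (Space d)) :
    ∫⁻ ω, (∫⁻ x in s, f (x +ᵥ ω)) ∂P = volume s * ∫⁻ ω, f ω ∂P := by
  rw [lintegral_lintegral_swap]
  · have : ∀ x : Space d, ∫⁻ ω, f (x +ᵥ ω) ∂P = ∫⁻ ω, f ω ∂P := fun x =>
      (measurePreserving_vadd x P).lintegral_comp hf
    simp [this, mul_comm]
  · exact (hf.comp (measurable_snd.vadd measurable_fst)).aemeasurable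

/-- Transference: the covering bound is applied on each orbit to the visits to the maximal set
inside the ball of radius `R`, and then integrated over `ω`. Invariance makes the two sides
multiples of `|B_R|` and `|B_{2R}|`; their ratio `2 ^ d` times the Vitali constant `5 ^ d` gives `10
^ d`. -/
lemma mul_measure_maximalSet_le (P : Measure Ω) [SFinite P]
    [VAddInvariantMeasure (Space d) Ω P] {f : Ω → ℝ≥0∞} (hf : Measurable f) (lam : ℝ≥0∞) (R : ℕ) :
    lam * P (maximalSet d f lam R) ≤ ENNReal.ofReal (10 ^ d) * ∫⁻ ω, f ω ∂P := by
  -- The argument divides by `|B_R|`, so `R = 0` is treated apart.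
  rcases R.eq_zero_or_pos with rfl | hR
  · have : maximalSet d f lam 0 = ∅ := by
      ext ω; simp only [maximalSet, mem_ofPred_eq, mem_empty_iff_false, iff_false]; grind
    simp [this]
  have hR' : (0 : ℝ) < R := by exact_mod_cast hR
  have hE := measurableSet_maximalSet (d := d) hf lam R
  have key : ∀ ω, lam * volume {x ∈ ball (0 : Space d) R | x +ᵥ ω ∈ maximalSet d f lam R} ≤
      ENNReal.ofReal (5 ^ d) * ∫⁻ y in ball (0 : Space d) (2 * R), f (y +ᵥ ω) := by
    intro ω
    refine mul_volume_le_of_forall_ball _ lam (sep_subset _ _) ?_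
    rintro x ⟨-, n, hn, hnR, hlt⟩
    refine ⟨n, by exact_mod_cast hn, by exact_mod_cast hnR, ?_⟩
    -- A ball about `x` on the orbit of `ω` is a ball about `0` on the orbit of `x +ᵥ ω`.
    have h1 : ∫⁻ y in ball x (n : ℝ), f (y +ᵥ ω) =
        ∫⁻ y in ball (0 : Space d) (n : ℝ), f (y +ᵥ x +ᵥ ω) := by
      have := (measurePreserving_add_right (volume : Measure (Space d)) x).setLIntegral_comp_preimage_emb
        (measurableEmbedding_addRight x) (fun y => f (y +ᵥ ω)) (ball x n)
      rw [← this]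
      simp [vadd_vadd]
    rw [h1, Measure.addHaar_ball_center]
    exact hlt.le
  have hvol : ∀ ω, ∫⁻ x in ball (0 : Space d) R,
      (maximalSet d f lam R).indicator (1 : Ω → ℝ≥0∞) (x +ᵥ ω) =
      volume {x ∈ ball (0 : Space d) R | x +ᵥ ω ∈ maximalSet d f lam R} := by
    intro ω
    have hm : MeasurableSet {x : Space d | x +ᵥ ω ∈ maximalSet d f lam R} :=
      (measurable_vadd_const ω) hE
    have : (fun x : Space d => (maximalSet d f lam R).indicator (1 : Ω → ℝ≥0∞) (x +ᵥ ω)) =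
        {x : Space d | x +ᵥ ω ∈ maximalSet d f lam R}.indicator 1 := by
      ext x; simp [indicator]
    rw [this, lintegral_indicator_one hm, Measure.restrict_apply hm, inter_comm]
    rfl
  have h2 : volume (ball (0 : Space d) R) * P (maximalSet d f lam R) =
      ∫⁻ ω, volume {x ∈ ball (0 : Space d) R | x +ᵥ ω ∈ maximalSet d f lam R} ∂P := by
    rw [← lintegral_indicator_one hE, ← lintegral_lintegral_vadd P (measurable_one.indicator hE)]
    simp_rw [hvol]
  have hV0 := volume_ball_ne_zero (0 : Space d) hR'
  have hVt : volume (ball (0 : Space d) R) ≠ ∞ := measure_ball_lt_top.ne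
  rw [← ENNReal.mul_le_mul_iff_right hV0 hVt]
  calc volume (ball (0 : Space d) R) * (lam * P (maximalSet d f lam R))
      = ∫⁻ ω, lam * volume {x ∈ ball (0 : Space d) R | x +ᵥ ω ∈ maximalSet d f lam R} ∂P := by
        rw [lintegral_const_mul, ← h2]
        · ring
        · simp_rw [← hvol]
          exact measurable_lintegral_vadd (measurable_one.indicator hE) _
    _ ≤ ∫⁻ ω, (ENNReal.ofReal (5 ^ d) * ∫⁻ y in ball (0 : Space d) (2 * R), f (y +ᵥ ω)) ∂P :=
        lintegral_mono key
    _ = ENNReal.ofReal (5 ^ d) * (volume (ball (0 : Space d) (2 * R)) * ∫⁻ ω, f ω ∂P) := by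
        rw [lintegral_const_mul _ (measurable_lintegral_vadd hf _), lintegral_lintegral_vadd P hf]
    _ = _ := by
        rw [volume_ball_of_pos _ (by positivity : 0 < 2 * (R : ℝ)), volume_ball_of_pos _ hR',
          mul_pow, show (10 : ℝ) = 5 * 2 by norm_num, mul_pow, ENNReal.ofReal_mul (by positivity),
          ENNReal.ofReal_mul (by positivity)]
        ring

/-- **Maximal inequality** for the averages of an action of `ℝ^d` over balls of integer radius. -/
lemma mul_measure_iUnion_maximalSet_le (P : Measure Ω) [SFinite P]
    [VAddInvariantMeasure (Space d) Ω P] {f : Ω → ℝ≥0∞} (hf : Measurable f) (lam : ℝ≥0∞) :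
    lam * P (⋃ R, maximalSet d f lam R) ≤ ENNReal.ofReal (10 ^ d) * ∫⁻ ω, f ω ∂P := by
  have hmono : Monotone (maximalSet d f lam) := fun R R' h ω ⟨n, h0, hn, hlt⟩ =>
    ⟨n, h0, hn.trans h, hlt⟩
  rw [hmono.measure_iUnion, ENNReal.mul_iSup]
  exact iSup_le fun R => mul_measure_maximalSet_le P hf lam R

end MaximalInequality

/-! ### Rescaled orbit averages and coboundaries. -/

section OrbitIntegral

open Metric

variable {d : ℕ} {Ω : Type*} [AddAction (Space d) Ω]

lemma lintegral_ball_comp_inv_smul (g : Space d → ℝ≥0∞) {ε : ℝ} (hε : 0 < ε) (ρ : ℝ) :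
    ∫⁻ x in ball 0 ρ, g (ε⁻¹ • x) =
      ENNReal.ofReal (ε ^ d) * ∫⁻ y in ball (0 : Space d) (ε⁻¹ * ρ), g y := by
  have hε' : ε⁻¹ ≠ 0 := (inv_pos.2 hε).ne'
  have hm : Measure.map (fun x : Space d => ε⁻¹ • x) volume =
      ENNReal.ofReal (ε ^ d) • volume := by
    rw [Measure.map_addHaar_smul _ hε']
    simp [abs_of_pos (pow_pos hε d)]
  have he : MeasurableEmbedding (fun x : Space d => ε⁻¹ • x) := measurableEmbedding_const_smul₀ hε'
  rw [← smul_eq_mul, ← lintegral_smul_measure, ← Measure.restrict_smul, ← hm, he.restrict_map,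
    he.lintegral_map]
  congr 2
  ext x
  simp only [mem_ball_zero_iff, mem_preimage, norm_smul, norm_inv, Real.norm_eq_abs, abs_of_pos hε]
  rw [mul_lt_mul_iff_right₀ (inv_pos.2 hε)]

/-- Rescaled averages of `h` along the orbit of `ω`, weighted by `φ`. -/
noncomputable def orbitIntegral {d : ℕ} {Ω : Type*} [AddAction (Space d) Ω] (φ : Space d → ℝ) (h : Ω → ℝ)
    (ω : Ω) (ε : ℝ) : ℝ :=
  ∫ x, φ x * h (ε⁻¹ • x +ᵥ ω)

/-- Off the maximal set every average over a ball of integer radius is at most `lam`. In the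
microscopic variable the support of `φ` has radius `ρ / ε`; rounding it up to an integer `n` gives
`ε n ≤ ρ + ε ≤ ρ + 1`, whence the power of `ρ + 1`. The bound is uniform in `ε` and linear in `lam`.
-/
lemma enorm_orbitIntegral_le {φ : Space d → ℝ} {K ρ : ℝ} (hK : ∀ x, |φ x| ≤ K)
    (hρ : 0 < ρ) (hφ : ∀ x ∉ ball 0 ρ, φ x = 0) {h : Ω → ℝ} {lam : ℝ≥0∞} {ω : Ω}
    (hω : ω ∉ ⋃ R, maximalSet d (fun ω => ‖h ω‖ₑ) lam R) {ε : ℝ} (hε : ε ∈ Ioo (0 : ℝ) 1) :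
    ‖orbitIntegral φ h ω ε‖ₑ ≤
      ENNReal.ofReal K * (ENNReal.ofReal ((ρ + 1) ^ d) * volume (ball (0 : Space d) 1)) * lam := by
  obtain ⟨hε0, hε1⟩ := hε
  have hn : ∀ n : ℕ, 0 < n →
      ∫⁻ x in ball (0 : Space d) n, ‖h (x +ᵥ ω)‖ₑ ≤ lam * volume (ball (0 : Space d) n) := by
    intro n hn
    by_contra! hcon
    exact hω (mem_iUnion.2 ⟨n, n, hn, le_rfl, hcon⟩)
  set n := ⌈ε⁻¹ * ρ⌉₊ with hndef
  have hn0 : 0 < n := Nat.ceil_pos.2 (by positivity)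
  have hnle : ε * n ≤ ρ + 1 := by
    have := (Nat.ceil_lt_add_one (by positivity : 0 ≤ ε⁻¹ * ρ)).le
    calc ε * n ≤ ε * (ε⁻¹ * ρ + 1) := by gcongr
      _ = ρ + ε := by field_simp
      _ ≤ ρ + 1 := by linarith
  calc ‖orbitIntegral φ h ω ε‖ₑ ≤ ∫⁻ x, ‖φ x * h (ε⁻¹ • x +ᵥ ω)‖ₑ := enorm_integral_le_lintegral_enorm _
    _ = ∫⁻ x in ball 0 ρ, ‖φ x * h (ε⁻¹ • x +ᵥ ω)‖ₑ := by
        rw [← lintegral_indicator measurableSet_ball]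
        congr 1 with x
        by_cases hx : x ∈ ball (0 : Space d) ρ
        · simp [hx]
        · simp [hx, hφ x hx]
    _ ≤ ∫⁻ x in ball (0 : Space d) ρ, ENNReal.ofReal K * ‖h (ε⁻¹ • x +ᵥ ω)‖ₑ := by
        refine lintegral_mono fun x => ?_
        rw [enorm_mul, Real.enorm_eq_ofReal_abs (φ x)]
        gcongr
        exact hK x
    _ = ENNReal.ofReal K * (ENNReal.ofReal (ε ^ d) *
          ∫⁻ y in ball (0 : Space d) (ε⁻¹ * ρ), ‖h (y +ᵥ ω)‖ₑ) := by
        rw [lintegral_const_mul' _ _ ENNReal.ofReal_ne_top,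
          lintegral_ball_comp_inv_smul (fun y => ‖h (y +ᵥ ω)‖ₑ) hε0]
    _ ≤ ENNReal.ofReal K * (ENNReal.ofReal (ε ^ d) * (lam * volume (ball (0 : Space d) n))) := by
        gcongr
        refine le_trans ?_ (hn n hn0)
        exact lintegral_mono_set (ball_subset_ball (Nat.le_ceil _))
    _ = ENNReal.ofReal K * (ENNReal.ofReal ((ε * n) ^ d) *
          volume (ball (0 : Space d) 1)) * lam := by
        rw [volume_ball_of_pos _ (by exact_mod_cast hn0 : (0 : ℝ) < n), mul_pow,
          ENNReal.ofReal_mul (by positivity)]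
        ring
    _ ≤ _ := by gcongr

variable [MeasurableSpace Ω]

lemma measurable_comp_orbit [MeasurableVAdd₂ (Space d) Ω] {h : Ω → ℝ} (hh : Measurable h)
    (ω : Ω) (ε : ℝ) : Measurable fun x : Space d => h (ε⁻¹ • x +ᵥ ω) :=
  hh.comp ((measurable_vadd_const ω).comp (measurable_const_smul _))

lemma integrable_mul_comp_orbit [MeasurableVAdd₂ (Space d) Ω] {φ : Space d → ℝ}
    (hφ : Integrable φ) {h : Ω → ℝ} (hh : Measurable h) {K : ℝ} (hK : ∀ ω, |h ω| ≤ K)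
    (ω : Ω) (ε : ℝ) : Integrable fun x : Space d => φ x * h (ε⁻¹ • x +ᵥ ω) :=
  hφ.mul_bdd (c := K) (measurable_comp_orbit hh ω ε).aestronglyMeasurable
    (Eventually.of_forall fun _ => hK _)

/-- Bounded observables whose rescaled orbit averages vanish in the limit, for every orbit. -/
structure HasVanishingAverages (d : ℕ) {Ω : Type*} [MeasurableSpace Ω] [AddAction (Space d) Ω]
    (h : Ω → ℝ) : Prop where
  measurable : Measurable h
  bounded : ∃ K, ∀ ω, |h ω| ≤ K
  tendsto : ∀ ω (φ : Space d → ℝ), Continuous φ → HasCompactSupport φ →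
    Tendsto (orbitIntegral φ h ω) (𝓝[>] 0) (𝓝 0)

lemma HasVanishingAverages.const_mul {h : Ω → ℝ} (hh : HasVanishingAverages d h) (c : ℝ) :
    HasVanishingAverages d (fun ω => c * h ω) where
  measurable := hh.measurable.const_mul c
  bounded := by
    obtain ⟨L, hL⟩ := hh.bounded
    exact ⟨|c| * L, fun ω => by rw [abs_mul]; gcongr; exact hL ω⟩
  tendsto ω φ hφ hφ' := by
    have := (hh.tendsto ω φ hφ hφ').const_mul c
    rw [mul_zero] at this
    refine this.congr fun ε => ?_
    simp only [orbitIntegral]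
    rw [← integral_const_mul]
    congr 1 with x
    ring

variable [MeasurableVAdd₂ (Space d) Ω]

lemma HasVanishingAverages.add {g h : Ω → ℝ} (hg : HasVanishingAverages d g)
    (hh : HasVanishingAverages d h) : HasVanishingAverages d (g + h) where
  measurable := hg.measurable.add hh.measurable
  bounded := by
    obtain ⟨K, hK⟩ := hg.bounded
    obtain ⟨L, hL⟩ := hh.bounded
    exact ⟨K + L, fun ω => (abs_add_le _ _).trans (add_le_add (hK ω) (hL ω))⟩
  tendsto ω φ hφ hφ' := by
    obtain ⟨K, hK⟩ := hg.bounded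
    obtain ⟨L, hL⟩ := hh.bounded
    have hi := hφ.integrable_of_hasCompactSupport (μ := volume) hφ'
    have := (hg.tendsto ω φ hφ hφ').add (hh.tendsto ω φ hφ hφ')
    rw [add_zero] at this
    refine this.congr fun ε => ?_
    simp only [orbitIntegral, Pi.add_apply, mul_add]
    rw [integral_add (integrable_mul_comp_orbit hi hg.measurable hK ω ε)
      (integrable_mul_comp_orbit hi hh.measurable hL ω ε)]

/-- Continuity of translations in `L¹`. For `ε < 1` both terms vanish outside one fixed ball, so a
constant on that ball dominates. -/
lemma tendsto_integral_abs_sub_translate {φ : Space d → ℝ} (hφ : Continuous φ)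
    (hφ' : HasCompactSupport φ) (y : Space d) :
    Tendsto (fun ε : ℝ => ∫ x, |φ x - φ (x - ε • y)|) (𝓝[>] 0) (𝓝 0) := by
  obtain ⟨K, hK⟩ := hφ.bounded_above_of_compact_support hφ'
  obtain ⟨ρ, hρ⟩ := hφ'.isCompact.isBounded.subset_closedBall 0
  have hout : ∀ x, ρ < ‖x‖ → φ x = 0 := fun x hx => by
    by_contra hne
    have := hρ (subset_tsupport φ hne)
    simp at this; linarith
  have := tendsto_integral_filter_of_dominated_convergence (μ := (volume : Measure (Space d)))
    (F := fun (ε : ℝ) x => |φ x - φ (x - ε • y)|) (f := fun _ => 0) (l := 𝓝[>] 0)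
    ((closedBall 0 (ρ + ‖y‖)).indicator fun _ => K + K) ?_ ?_ ?_ ?_
  · simpa using this
  · exact Eventually.of_forall fun ε => (by fun_prop : Continuous _).aestronglyMeasurable
  · filter_upwards [Ioo_mem_nhdsGT (zero_lt_one (α := ℝ))] with ε hε
    refine Eventually.of_forall fun x => ?_
    by_cases hx : x ∈ closedBall (0 : Space d) (ρ + ‖y‖)
    · rw [indicator_of_mem hx, Real.norm_eq_abs, abs_abs]
      exact (abs_sub _ _).trans (add_le_add (hK _) (hK _))
    · rw [indicator_of_notMem hx]
      simp only [mem_closedBall_zero_iff, not_le] at hx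
      have h1 : ‖ε • y‖ ≤ ‖y‖ := by
        rw [norm_smul, Real.norm_eq_abs, abs_of_pos hε.1]
        exact mul_le_of_le_one_left (norm_nonneg _) hε.2.le
      have h2 : ‖x‖ - ‖ε • y‖ ≤ ‖x - ε • y‖ := norm_sub_norm_le _ _
      rw [hout x (by linarith [norm_nonneg y]), hout (x - ε • y) (by linarith)]
      simp
  · exact (integrable_indicator_iff measurableSet_closedBall).2
      (integrableOn_const measure_closedBall_lt_top.ne)
  · refine Eventually.of_forall fun x => ?_
    have hc : Continuous fun ε : ℝ => |φ x - φ (x - ε • y)| := by fun_prop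
    have := hc.tendsto 0
    simp only [zero_smul, sub_zero, sub_self, abs_zero] at this
    exact this.mono_left nhdsWithin_le_nhds

/-- The shift by `y` along the orbit is a shift by `ε y` in the macroscopic variable. Moving it onto
`φ` bounds the average by `K ∫ |φ - φ(· - ε y)|`, for every `ω`. -/
lemma hasVanishingAverages_coboundary {g : Ω → ℝ} (hg : Measurable g) {K : ℝ}
    (hK : ∀ ω, |g ω| ≤ K) (y : Space d) :
    HasVanishingAverages d (fun ω => g ω - g (y +ᵥ ω)) where
  measurable := hg.sub (hg.comp (measurable_const_vadd y))
  bounded := ⟨K + K, fun ω => (abs_sub _ _).trans (add_le_add (hK _) (hK _))⟩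
  tendsto ω φ hφ hφ' := by
    have hlim := (tendsto_integral_abs_sub_translate hφ hφ' y).const_mul K
    rw [mul_zero] at hlim
    refine squeeze_zero_norm' ?_ hlim
    filter_upwards [self_mem_nhdsWithin] with ε hε
    have hε' : ε ≠ 0 := ne_of_gt hε
    have hi := hφ.integrable_of_hasCompactSupport (μ := volume) hφ'
    have hi' : Integrable fun x => φ (x - ε • y) := hi.comp_sub_right _
    have hi1 := integrable_mul_comp_orbit hi hg hK ω ε
    have hi2 := integrable_mul_comp_orbit hi' hg hK ω ε
    have hshift : ∫ x, φ x * g (y +ᵥ ε⁻¹ • x +ᵥ ω) = ∫ x, φ (x - ε • y) * g (ε⁻¹ • x +ᵥ ω) := by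
      rw [← integral_sub_right_eq_self (fun x => φ x * g (y +ᵥ ε⁻¹ • x +ᵥ ω)) (ε • y)]
      congr 1 with x
      rw [vadd_vadd, smul_sub, inv_smul_smul₀ hε', add_sub_cancel]
    have hi3 : Integrable fun x => φ x * g (y +ᵥ ε⁻¹ • x +ᵥ ω) :=
      integrable_mul_comp_orbit hi (hg.comp (measurable_const_vadd y)) (fun ω => hK _) ω ε
    have heq : orbitIntegral φ (fun ω => g ω - g (y +ᵥ ω)) ω ε =
        ∫ x, (φ x - φ (x - ε • y)) * g (ε⁻¹ • x +ᵥ ω) := by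
      simp only [orbitIntegral, mul_sub, sub_mul]
      rw [integral_sub hi1 hi3, integral_sub hi1 hi2, hshift]
    rw [heq, ← integral_const_mul]
    refine norm_integral_le_of_norm_le ((hi.sub hi').abs.const_mul K)
      (Eventually.of_forall fun x => ?_)
    rw [norm_mul, mul_comm]
    exact mul_le_mul_of_nonneg_right (hK _) (norm_nonneg _)

end OrbitIntegral

/-! ### The pointwise ergodic theorem. -/

section PointwiseErgodic

open Metric

variable {d : ℕ} {Ω : Type*} [MeasurableSpace Ω] [AddAction (Space d) Ω]

/-- Each preimage under `u` of a measurable set is invariant up to null sets, hence null or conull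
by ergodicity; countably many measurable sets separate the points of `ℝ`. -/
lemma ae_eq_const_of_forall_comp_vadd (P : Measure Ω) [ErgodicVAdd (Space d) Ω P] {u : Ω → ℝ}
    (hu : AEStronglyMeasurable u P)
    (h : ∀ y : Space d, (fun ω => u (y +ᵥ ω)) =ᵐ[P] u) : ∃ c, u =ᵐ[P] fun _ => c := by
  refine exists_eventuallyEq_const_of_forall_separating (β := ℝ) MeasurableSet fun U hU => ?_
  have hc := aeconst_of_forall_preimage_vadd_ae_eq (Space d) (s := u ⁻¹' U)
    (hu.aemeasurable.nullMeasurable hU) fun y => by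
      filter_upwards [h y] with ω hω
      simp only [eq_iff_iff]
      change u (y +ᵥ ω) ∈ U ↔ u ω ∈ U
      rw [hω]
  exact eventuallyConst_set.1 hc

variable [MeasurableVAdd₂ (Space d) Ω]

/-- The subspace of `L²(P)` of classes of observables with vanishing rescaled averages. -/
def vanishingSubmodule (d : ℕ) {Ω : Type*} [MeasurableSpace Ω] [AddAction (Space d) Ω]
    [MeasurableVAdd₂ (Space d) Ω] (P : Measure Ω) : Submodule ℝ (Lp ℝ 2 P) where
  carrier := {u | ∃ h, HasVanishingAverages d h ∧ u =ᵐ[P] h}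
  add_mem' := by
    rintro u v ⟨g, hg, hug⟩ ⟨h, hh, hvh⟩
    exact ⟨g + h, hg.add hh, (Lp.coeFn_add u v).trans (hug.add hvh)⟩
  zero_mem' := ⟨fun _ => 0, ⟨measurable_const, ⟨0, by simp⟩, fun ω φ _ _ => by
    have : orbitIntegral φ (fun _ : Ω => (0 : ℝ)) ω = fun _ => 0 := by
      ext ε; simp [orbitIntegral]
    rw [this]; exact tendsto_const_nhds⟩, Lp.coeFn_zero ℝ 2 P⟩
  smul_mem' := by
    rintro c u ⟨h, hh, huh⟩
    refine ⟨_, hh.const_mul c, ?_⟩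
    filter_upwards [Lp.coeFn_smul c u, huh] with ω h1 h2
    rw [h1, Pi.smul_apply, h2, smul_eq_mul]

/-- Orthogonality to the coboundaries of indicators suffices: it says that `u` has the same integral
over `B` and over its preimage under the shift by `-y`. The latter integral equals that of `u (y +ᵥ
·)` over `B`, so `u` is invariant and ergodicity applies. -/
lemma exists_const_of_mem_orthogonal (P : Measure Ω) [IsProbabilityMeasure P]
    [ErgodicVAdd (Space d) Ω P] {u : Lp ℝ 2 P} (hu : u ∈ (vanishingSubmodule d P)ᗮ) :
    ∃ c : ℝ, u =ᵐ[P] fun _ => c := by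
  have hui : Integrable u P := (Lp.memLp u).integrable (by norm_num)
  refine ae_eq_const_of_forall_comp_vadd (d := d) P (Lp.aestronglyMeasurable u) fun y => ?_
  have hmp := measurePreserving_vadd y P
  have huy : Integrable (fun ω => u (y +ᵥ ω)) P := hmp.integrable_comp_of_integrable hui
  refine Integrable.ae_eq_of_forall_setIntegral_eq _ _ huy hui fun B hB _ => ?_
  have hmn := measurePreserving_vadd (-y) P
  have hB' : MeasurableSet ((fun ω : Ω => -y +ᵥ ω) ⁻¹' B) := measurable_const_vadd (-y) hB
  have hmem : indicatorConstLp 2 hB (measure_ne_top P B) (1 : ℝ) -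
      indicatorConstLp 2 hB' (measure_ne_top P _) (1 : ℝ) ∈ vanishingSubmodule d P := by
    refine ⟨_, hasVanishingAverages_coboundary (d := d) (g := B.indicator 1) (K := 1)
      (measurable_one.indicator hB) (fun ω => ?_) (-y), ?_⟩
    · by_cases hω : ω ∈ B <;> simp [hω]
    · filter_upwards [Lp.coeFn_sub (indicatorConstLp 2 hB (measure_ne_top P B) (1 : ℝ))
        (indicatorConstLp 2 hB' (measure_ne_top P _) (1 : ℝ)),
        indicatorConstLp_coeFn (p := 2) (hs := hB) (hμs := measure_ne_top P B) (c := (1 : ℝ)),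
        indicatorConstLp_coeFn (p := 2) (hs := hB') (hμs := measure_ne_top P _) (c := (1 : ℝ))]
        with ω h1 h2 h3
      rw [h1, Pi.sub_apply, h2, h3]
      rfl
  have horth := (Submodule.mem_orthogonal _ _).1 hu _ hmem
  rw [inner_sub_left, L2.inner_indicatorConstLp_one, L2.inner_indicatorConstLp_one,
    sub_eq_zero] at horth
  rw [horth]
  have hemb : MeasurableEmbedding (fun ω : Ω => -y +ᵥ ω) := measurableEmbedding_const_vadd _
  rw [← hmn.setIntegral_preimage_emb hemb]
  simp

/-- Centred bounded observables are approximated in `L¹(P)` by observables with vanishing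
rescaled averages. -/
lemma exists_hasVanishingAverages_lintegral_le (P : Measure Ω) [IsProbabilityMeasure P]
    [ErgodicVAdd (Space d) Ω P] {f : Ω → ℝ} (hf : Measurable f) {M : ℝ} (hM : ∀ ω, |f ω| ≤ M)
    {η : ℝ} (hη : 0 < η) :
    ∃ h, HasVanishingAverages d h ∧ ∫⁻ ω, ‖f ω - (∫ ω', f ω' ∂P) - h ω‖ₑ ∂P ≤ ENNReal.ofReal η := by
  set c := ∫ ω', f ω' ∂P
  have hfm : MemLp (fun ω => f ω - c) 2 P :=
    MemLp.of_bound (hf.sub_const c).aestronglyMeasurable (M + |c|)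
      (Eventually.of_forall fun ω => (abs_sub _ _).trans (by gcongr; exact hM ω))
  have hfi : Integrable f P := Integrable.of_bound hf.aestronglyMeasurable M
    (Eventually.of_forall hM)
  -- The orthogonal complement contains only constants, and these are orthogonal to the centred `f`.
  -- The double complement is the closure.
  have hmem : hfm.toLp _ ∈ (vanishingSubmodule d P)ᗮᗮ := by
    rw [Submodule.mem_orthogonal]
    intro u hu
    obtain ⟨a, ha⟩ := exists_const_of_mem_orthogonal P hu
    rw [L2.inner_def]
    have : ∫ ω, inner ℝ (u ω) (hfm.toLp _ ω) ∂P = ∫ ω, (f ω - c) * a ∂P := by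
      refine integral_congr_ae ?_
      filter_upwards [ha, hfm.coeFn_toLp] with ω h1 h2
      rw [h1, h2]
      simp
    rw [this, integral_mul_const, integral_sub hfi (integrable_const c)]
    simp [c]
  rw [Submodule.orthogonal_orthogonal_eq_closure, ← SetLike.mem_coe,
    Submodule.topologicalClosure_coe, Metric.mem_closure_iff] at hmem
  obtain ⟨v, ⟨h, hh, hvh⟩, hdist⟩ := hmem η hη
  refine ⟨h, hh, ?_⟩
  have hsm : AEStronglyMeasurable (fun ω => f ω - c - h ω) P :=
    ((hf.sub_const c).sub hh.measurable).aestronglyMeasurable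
  calc ∫⁻ ω, ‖f ω - c - h ω‖ₑ ∂P = eLpNorm (fun ω => f ω - c - h ω) 1 P := by
        rw [eLpNorm_one_eq_lintegral_enorm]
    _ ≤ eLpNorm (fun ω => f ω - c - h ω) 2 P :=
        eLpNorm_le_eLpNorm_of_exponent_le (by norm_num) hsm
    _ = edist (hfm.toLp _) v := by
        rw [Lp.edist_def]
        refine eLpNorm_congr_ae ?_
        filter_upwards [hfm.coeFn_toLp, hvh] with ω h1 h2
        rw [Pi.sub_apply, h1, h2]
    _ ≤ ENNReal.ofReal η := by
        rw [edist_dist]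
        exact ENNReal.ofReal_le_ofReal hdist.le

/-- Split the centred `f` as `h + k` with `h` of vanishing averages and `k` small in `L¹`. Averages
of `k` stay below `δ / 2` off a maximal set, whose probability the maximal inequality makes smaller
than any given `η`. -/
lemma ae_eventually_orbitIntegral_le (P : Measure Ω) [IsProbabilityMeasure P]
    [ErgodicVAdd (Space d) Ω P] {f : Ω → ℝ} (hf : Measurable f) {M : ℝ} (hM : ∀ ω, |f ω| ≤ M)
    {φ : Space d → ℝ} (hφ : Continuous φ) (hφ' : HasCompactSupport φ) {δ : ℝ} (hδ : 0 < δ) :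
    ∀ᵐ ω ∂P, ∀ᶠ ε in 𝓝[>] (0 : ℝ),
      |orbitIntegral φ (fun ω => f ω - ∫ ω', f ω' ∂P) ω ε| ≤ δ := by
  obtain ⟨K, hK⟩ := hφ.bounded_above_of_compact_support hφ'
  obtain ⟨ρ, hρ0, hρ⟩ := hφ'.isCompact.isBounded.subset_ball_lt 0 0
  have hout : ∀ x ∉ ball 0 ρ, φ x = 0 := fun x hx => by
    by_contra hne
    exact hx (hρ (subset_tsupport φ hne))
  set c := ∫ ω', f ω' ∂P
  have hi := hφ.integrable_of_hasCompactSupport (μ := volume) hφ'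
  set A := ENNReal.ofReal K * (ENNReal.ofReal ((ρ + 1) ^ d) * volume (ball (0 : Space d) 1))
  have hA : A ≠ ∞ := ENNReal.mul_ne_top ENNReal.ofReal_ne_top
    (ENNReal.mul_ne_top ENNReal.ofReal_ne_top measure_ball_lt_top.ne)
  obtain ⟨lam, hlam0, hlam⟩ : ∃ lam : ℝ, 0 < lam ∧ A * ENNReal.ofReal lam ≤ ENNReal.ofReal (δ / 2) := by
    refine ⟨δ / 2 / (A.toReal + 1), by positivity, ?_⟩
    rw [← ENNReal.ofReal_toReal hA, ← ENNReal.ofReal_mul ENNReal.toReal_nonneg]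
    refine ENNReal.ofReal_le_ofReal ?_
    rw [ENNReal.toReal_ofReal ENNReal.toReal_nonneg, mul_div_assoc', div_le_iff₀ (by positivity)]
    nlinarith [A.toReal_nonneg]
  have hlam' : ENNReal.ofReal lam ≠ 0 := by simpa using hlam0
  rw [ae_iff]
  refine le_antisymm (le_of_forall_pos_le_add fun η hη => ?_) zero_le
  rw [zero_add]
  rcases eq_or_ne η ∞ with rfl | hηt
  · exact le_top
  have hη' : 0 < η.toReal := ENNReal.toReal_pos hη.ne' hηt
  -- This size of the `L¹` error cancels the constant `10 ^ d` and the level `lam` of the maximal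
  -- inequality, leaving `η`.
  obtain ⟨h, hh, hle⟩ := exists_hasVanishingAverages_lintegral_le (d := d) P hf hM
    (η := lam * η.toReal / 10 ^ d) (by positivity)
  obtain ⟨L, hL⟩ := hh.bounded
  set k : Ω → ℝ := fun ω => f ω - c - h ω
  have hk : Measurable k := (hf.sub_const c).sub hh.measurable
  have hkb : ∀ ω, |k ω| ≤ M + |c| + L := fun ω =>
    (abs_sub _ _).trans (add_le_add ((abs_sub _ _).trans (by gcongr; exact hM ω)) (hL ω))
  have hsub : {ω | ¬ ∀ᶠ ε in 𝓝[>] (0 : ℝ), |orbitIntegral φ (fun ω => f ω - c) ω ε| ≤ δ} ⊆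
      ⋃ R, maximalSet d (fun ω => ‖k ω‖ₑ) (ENNReal.ofReal lam) R := by
    intro ω hω
    by_contra hnot
    refine hω ?_
    have h0 := (hh.tendsto ω φ hφ hφ').eventually (Metric.ball_mem_nhds 0 (half_pos hδ))
    filter_upwards [h0, Ioo_mem_nhdsGT (zero_lt_one (α := ℝ))] with ε h1 hε
    have hsplit : orbitIntegral φ (fun ω => f ω - c) ω ε =
        orbitIntegral φ k ω ε + orbitIntegral φ h ω ε := by
      simp only [orbitIntegral]
      rw [← integral_add (integrable_mul_comp_orbit hi hk hkb ω ε)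
        (integrable_mul_comp_orbit hi hh.measurable hL ω ε)]
      congr 1 with x
      simp only [k]; ring
    have h2 := (enorm_orbitIntegral_le hK hρ0 hout hnot hε).trans hlam
    rw [Real.enorm_eq_ofReal_abs, ENNReal.ofReal_le_ofReal_iff (by positivity)] at h2
    rw [hsplit]
    rw [Real.dist_eq, sub_zero] at h1
    linarith [abs_add_le (orbitIntegral φ k ω ε) (orbitIntegral φ h ω ε)]
  have hmax := mul_measure_iUnion_maximalSet_le (d := d) P hk.enorm (ENNReal.ofReal lam)
  refine (measure_mono hsub).trans ?_
  rw [← ENNReal.mul_le_mul_iff_right hlam' ENNReal.ofReal_ne_top]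
  refine hmax.trans ((mul_le_mul_right hle _).trans ?_)
  rw [← ENNReal.ofReal_mul (by positivity), mul_div_cancel₀ _ (by positivity),
    ENNReal.ofReal_mul hlam0.le, ENNReal.ofReal_toReal hηt]

/-- Multiparameter **pointwise ergodic theorem** in weak form, for compactly supported weights. -/
lemma ae_tendsto_orbitIntegral_of_hasCompactSupport (P : Measure Ω) [IsProbabilityMeasure P]
    [ErgodicVAdd (Space d) Ω P] {f : Ω → ℝ} (hf : Measurable f) {M : ℝ} (hM : ∀ ω, |f ω| ≤ M)
    {φ : Space d → ℝ} (hφ : Continuous φ) (hφ' : HasCompactSupport φ) :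
    ∀ᵐ ω ∂P, Tendsto (orbitIntegral φ f ω) (𝓝[>] 0) (𝓝 ((∫ x, φ x) * ∫ ω', f ω' ∂P)) := by
  have hall : ∀ᵐ ω ∂P, ∀ n : ℕ, ∀ᶠ ε in 𝓝[>] (0 : ℝ),
      |orbitIntegral φ (fun ω => f ω - ∫ ω', f ω' ∂P) ω ε| ≤ 1 / ((n : ℝ) + 1) :=
    ae_all_iff.2 fun n => ae_eventually_orbitIntegral_le P hf hM hφ hφ' (by positivity)
  have hi := hφ.integrable_of_hasCompactSupport (μ := volume) hφ'
  filter_upwards [hall] with ω hω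
  rw [Metric.tendsto_nhds]
  intro δ hδ
  obtain ⟨n, hn⟩ := exists_nat_one_div_lt hδ
  filter_upwards [hω n] with ε hε
  rw [Real.dist_eq]
  refine lt_of_le_of_lt (le_of_eq_of_le ?_ hε) hn
  simp only [orbitIntegral, mul_sub]
  rw [integral_sub (integrable_mul_comp_orbit hi hf hM ω ε) (hi.mul_const _), integral_mul_const]

/-- Multiparameter **pointwise ergodic theorem** in weak form. -/
theorem ae_tendsto_orbitIntegral (P : Measure Ω) [IsProbabilityMeasure P]
    [ErgodicVAdd (Space d) Ω P] {f : Ω → ℝ} (hf : Measurable f) {M : ℝ} (hM : ∀ ω, |f ω| ≤ M)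
    {φ : Space d → ℝ} (hφ : Integrable φ) :
    ∀ᵐ ω ∂P, Tendsto (orbitIntegral φ f ω) (𝓝[>] 0) (𝓝 ((∫ x, φ x) * ∫ ω', f ω' ∂P)) := by
  have happ : ∀ n : ℕ, ∃ g : Space d → ℝ, HasCompactSupport g ∧
      ∫ x, ‖φ x - g x‖ ≤ 1 / ((n : ℝ) + 1) ∧ Continuous g ∧ Integrable g := fun n =>
    hφ.exists_hasCompactSupport_integral_sub_le (by positivity)
  choose g hgs hgle hgc hgi using happ
  set c := ∫ ω', f ω' ∂P
  have hM' : ∀ ω, |f ω| ≤ |M| := fun ω => (hM ω).trans (le_abs_self M)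
  -- The exceptional null set depends on the weight, so the approximation uses a sequence. Orbit
  -- integrals and their limits are Lipschitz in the `L¹` norm of the weight, with constants `|M|`
  -- and `|c|` independent of `ε`.
  have hall := ae_all_iff.2 fun n =>
    ae_tendsto_orbitIntegral_of_hasCompactSupport P hf hM (hgc n) (hgs n)
  filter_upwards [hall] with ω hω
  rw [Metric.tendsto_nhds]
  intro δ hδ
  have hpos : 0 < δ / 2 / (|M| + |c| + 1) := by positivity
  obtain ⟨n, hn⟩ := exists_nat_one_div_lt hpos
  have hgn : (∫ x, ‖φ x - g n x‖) * (|M| + |c|) ≤ δ / 2 := by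
    have := ((hgle n).trans hn.le)
    rw [le_div_iff₀ (by positivity)] at this
    have h0 : 0 ≤ ∫ x, ‖φ x - g n x‖ := integral_nonneg fun _ => norm_nonneg _
    nlinarith
  filter_upwards [(hω n).eventually (Metric.ball_mem_nhds _ (half_pos hδ))] with ε hε
  rw [Real.dist_eq] at hε
  change |_ - _ * c| < _ at hε
  rw [Real.dist_eq]
  have hni := (hφ.sub (hgi n)).norm
  have h1 : |orbitIntegral φ f ω ε - orbitIntegral (g n) f ω ε| ≤
      (∫ x, ‖φ x - g n x‖) * |M| := by
    simp only [orbitIntegral]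
    rw [← integral_sub (integrable_mul_comp_orbit hφ hf hM ω ε)
      (integrable_mul_comp_orbit (hgi n) hf hM ω ε), ← integral_mul_const]
    rw [← Real.norm_eq_abs]
    refine norm_integral_le_of_norm_le (hni.mul_const _) (Eventually.of_forall fun x => ?_)
    rw [← sub_mul, norm_mul]
    exact mul_le_mul_of_nonneg_left (hM' _) (norm_nonneg _)
  have h2 : |(∫ x, φ x) * c - (∫ x, g n x) * c| ≤ (∫ x, ‖φ x - g n x‖) * |c| := by
    rw [← sub_mul, abs_mul, ← integral_sub hφ (hgi n)]
    gcongr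
    rw [← Real.norm_eq_abs]
    exact norm_integral_le_integral_norm _
  have h3 := abs_sub_le (orbitIntegral φ f ω ε) (orbitIntegral (g n) f ω ε) ((∫ x, φ x) * c)
  have h4 := abs_sub_le (orbitIntegral (g n) f ω ε) ((∫ x, g n x) * c) ((∫ x, φ x) * c)
  rw [abs_sub_comm ((∫ x, g n x) * c)] at h4
  linarith

/-- The pointwise ergodic theorem for the event `A`: rescaled visit sets of almost every orbit
converge weakly to the constant density `P A`. -/
theorem ae_tendsto_setIntegral_vadd_mem (P : Measure Ω) [IsProbabilityMeasure P]
    [ErgodicVAdd (Space d) Ω P] {A : Set Ω} (hA : MeasurableSet A) {φ : Space d → ℝ}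
    (hφ : Integrable φ) :
    ∀ᵐ ω ∂P, Tendsto (fun ε : ℝ => ∫ x in {x : Space d | ε⁻¹ • x +ᵥ ω ∈ A}, φ x) (𝓝[>] 0)
      (𝓝 ((∫ x, φ x) * P.real A)) := by
  have := ae_tendsto_orbitIntegral P (f := A.indicator 1) (measurable_one.indicator hA) (M := 1)
    (fun ω => by by_cases h : ω ∈ A <;> simp [h]) hφ
  rw [integral_indicator_one hA] at this
  filter_upwards [this] with ω hω
  refine hω.congr fun ε => ?_
  have hm : MeasurableSet {x : Space d | ε⁻¹ • x +ᵥ ω ∈ A} :=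
    (((measurable_vadd_const ω).comp (measurable_const_smul ε⁻¹)) : Measurable _) hA
  rw [← integral_indicator hm, orbitIntegral]
  congr 1 with x
  by_cases h : ε⁻¹ • x +ᵥ ω ∈ A
  · simp [h]
  · simp [h]

end PointwiseErgodic

/-! ### Rigid copies, connected components and the change of variables on an inclusion. -/

section Geometry

variable {d : ℕ}

lemma RigidMotion.image_eq (m : RigidMotion d) (D : Set (Space d)) :
    m.image D = m.rot.toHomeomorph.trans (Homeomorph.addRight m.trans) '' D := rfl

lemma RigidMotion.isOpen_image (m : RigidMotion d) {D : Set (Space d)} (hD : IsOpen D) :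
    IsOpen (m.image D) := by
  rw [m.image_eq]
  exact (Homeomorph.isOpen_image _).2 hD

lemma IsRigidCopy.isOpen {D C : Set (Space d)} (h : IsRigidCopy D C) (hD : IsOpen D) :
    IsOpen C := by
  obtain ⟨m, rfl⟩ := h
  exact m.isOpen_image hD

/-- Compose one motion with the inverse of the other; the rotation stays in `SO(d)`. Consequently
each inclusion has only one shape index. -/
lemma IsRigidCopy.of_common {D D' C : Set (Space d)} (h : IsRigidCopy D C)
    (h' : IsRigidCopy D' C) : IsRigidCopy D D' := by
  obtain ⟨m, rfl⟩ := h
  obtain ⟨m', hm'⟩ := h'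
  refine ⟨⟨m.rot.trans m'.rot.symm, ?_, m'.rot.symm (m.trans - m'.trans)⟩, ?_⟩
  · have h1 : LinearMap.det (m'.rot.symm.toLinearEquiv : Space d →ₗ[ℝ] Space d) = 1 := by
      have h2 := LinearEquiv.det_symm_mul_det m'.rot.toLinearEquiv
      rw [m'.det_rot, mul_one] at h2
      exact h2
    have h3 : ((m.rot.trans m'.rot.symm).toLinearEquiv : Space d →ₗ[ℝ] Space d) =
        (m'.rot.symm.toLinearEquiv : Space d →ₗ[ℝ] Space d) ∘ₗ
          (m.rot.toLinearEquiv : Space d →ₗ[ℝ] Space d) := rfl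
    rw [h3, LinearMap.det_comp, h1, m.det_rot, one_mul]
  · have hinj : Function.Injective fun ξ : Space d => m'.rot ξ + m'.trans :=
      (add_left_injective _).comp m'.rot.injective
    apply hinj.image_injective
    change m'.image _ = m'.image D'
    rw [hm']
    simp only [RigidMotion.image, image_image]
    congr 1
    ext1 ξ
    simp [add_assoc]

lemma IsRigidCopy.image_add_right {D C : Set (Space d)} (h : IsRigidCopy D C) (x : Space d) :
    IsRigidCopy D ((· + x) '' C) := by
  obtain ⟨m, rfl⟩ := h
  refine ⟨⟨m.rot, m.det_rot, m.trans + x⟩, ?_⟩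
  simp only [RigidMotion.image, image_image, add_assoc]

lemma isRigidCopy_image_add_right_iff {D C : Set (Space d)} (x : Space d) :
    IsRigidCopy D ((· + x) '' C) ↔ IsRigidCopy D C := by
  refine ⟨fun h => ?_, fun h => h.image_add_right x⟩
  have := h.image_add_right (-x)
  simpa only [image_image, add_neg_cancel_right, image_id'] using this

/-- Translations carry components to components. With homogeneity this turns membership of `x` in
`𝒢_j` into an event at the origin for the shifted medium. -/
lemma zero_mem_copiesIn_translate (G D : Set (Space d)) (x : Space d) :
    (0 : Space d) ∈ copiesIn {z | z + x ∈ G} D ↔ x ∈ copiesIn G D := by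
  have hG : (· + x) '' {z | z + x ∈ G} = G := by
    ext z
    simp only [mem_image, mem_ofPred_eq]
    exact ⟨fun ⟨y, hy, hz⟩ => hz ▸ hy, fun hz => ⟨z - x, by simpa using hz, by simp⟩⟩
  simp only [copiesIn, mem_ofPred_eq, zero_add]
  refine and_congr_right fun hx => ?_
  have := (Homeomorph.addRight x).image_connectedComponentIn (s := {z | z + x ∈ G})
    (x := 0) (by simpa using hx)
  simp only [Homeomorph.coe_addRight, zero_add] at this
  rw [hG] at this
  rw [← this, isRigidCopy_image_add_right_iff]

/-- The connected components of `G` that are rigid copies of `D`. -/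
def cells (G D : Set (Space d)) : Set (Set (Space d)) :=
  (fun x => connectedComponentIn G x) '' copiesIn G D

lemma cells_isRigidCopy {G D C : Set (Space d)} (hC : C ∈ cells G D) : IsRigidCopy D C := by
  obtain ⟨x, hx, rfl⟩ := hC
  exact hx.2

lemma connectedComponentIn_of_mem_cell {G D C : Set (Space d)} (hC : C ∈ cells G D)
    {x : Space d} (hx : x ∈ C) : connectedComponentIn G x = C := by
  obtain ⟨y, hy, rfl⟩ := hC
  exact (connectedComponentIn_eq hx).symm

lemma cell_subset_copiesIn {G D C : Set (Space d)} (hC : C ∈ cells G D) : C ⊆ copiesIn G D := by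
  intro x hx
  have h1 := connectedComponentIn_of_mem_cell hC hx
  refine ⟨?_, ?_⟩
  · obtain ⟨y, hy, rfl⟩ := hC
    exact connectedComponentIn_subset G y hx
  · rw [h1]
    exact cells_isRigidCopy hC

lemma biUnion_cells (G D : Set (Space d)) : ⋃ C ∈ cells G D, C = copiesIn G D := by
  refine Subset.antisymm (iUnion₂_subset fun C hC => cell_subset_copiesIn hC) fun x hx => ?_
  exact mem_biUnion (mem_image_of_mem _ hx) (mem_connectedComponentIn hx.1)

lemma isOpen_cell {G D C : Set (Space d)} (hD : IsOpen D) (hC : C ∈ cells G D) : IsOpen C :=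
  (cells_isRigidCopy hC).isOpen hD

lemma isOpen_copiesIn {G D : Set (Space d)} (hD : IsOpen D) : IsOpen (copiesIn G D) := by
  rw [← biUnion_cells]
  exact isOpen_biUnion fun C hC => isOpen_cell hD hC

lemma nonempty_cell {G D C : Set (Space d)} (hC : C ∈ cells G D) : C.Nonempty := by
  obtain ⟨x, hx, rfl⟩ := hC
  exact ⟨x, mem_connectedComponentIn hx.1⟩

lemma pairwiseDisjoint_cells (G D : Set (Space d)) : (cells G D).PairwiseDisjoint id := by
  intro C hC C' hC' hne
  refine Set.disjoint_left.2 fun x hx hx' => hne ?_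
  rw [← connectedComponentIn_of_mem_cell hC hx, ← connectedComponentIn_of_mem_cell hC' hx']

/-- Disjoint nonempty open sets in a separable space. Countability is what allows measurability and
null sets to be checked inclusion by inclusion. -/
lemma countable_cells {G D : Set (Space d)} (hD : IsOpen D) : (cells G D).Countable :=
  (pairwiseDisjoint_cells G D).countable_of_isOpen (fun _ hC => isOpen_cell hD hC)
    fun _ hC => nonempty_cell hC

/-- The map `x ↦ R⁻¹ (x - ε y) / ε` from the scaled inclusion `ε (R D + y)` to `D`. -/
noncomputable def RigidMotion.pull (m : RigidMotion d) (ε : ℝ) (x : Space d) : Space d :=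
  m.rot.symm (ε⁻¹ • (x - ε • m.trans))

lemma RigidMotion.measurableEmbedding_pull (m : RigidMotion d) {ε : ℝ} (hε : 0 < ε) :
    MeasurableEmbedding (m.pull ε) :=
  m.rot.symm.toHomeomorph.measurableEmbedding.comp
    ((measurableEmbedding_const_smul₀ (inv_pos.2 hε).ne').comp
      (measurableEmbedding_subRight (ε • m.trans)))

lemma RigidMotion.map_pull (m : RigidMotion d) {ε : ℝ} (hε : 0 < ε) :
    Measure.map (m.pull ε) volume = ENNReal.ofReal (ε ^ d) • (volume : Measure (Space d)) := by
  have h1 := (measurePreserving_sub_right (volume : Measure (Space d)) (ε • m.trans)).map_eq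
  have h2 := Measure.map_addHaar_smul (volume : Measure (Space d)) (inv_pos.2 hε).ne'
  have h3 := m.rot.symm.measurePreserving.map_eq
  have hcomp : m.pull ε = m.rot.symm ∘ (fun x => ε⁻¹ • x) ∘ fun x => x - ε • m.trans := rfl
  rw [hcomp, ← Measure.map_map m.rot.symm.continuous.measurable (by fun_prop),
    ← Measure.map_map (by fun_prop) (by fun_prop), h1, h2, Measure.map_smul, h3]
  simp [abs_of_pos (pow_pos hε d)]

lemma RigidMotion.preimage_pull (m : RigidMotion d) {ε : ℝ} (hε : 0 < ε) (D : Set (Space d)) :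
    m.pull ε ⁻¹' D = ε • m.image D := by
  ext x
  rw [mem_smul_set_iff_inv_smul_mem₀ hε.ne', mem_preimage, RigidMotion.pull, smul_sub,
    inv_smul_smul₀ hε.ne', RigidMotion.image]
  simp only [mem_image]
  constructor
  · intro h
    exact ⟨_, h, by simp⟩
  · rintro ⟨ξ, hξ, hx⟩
    rw [← hx]
    simpa using hξ

lemma RigidMotion.map_restrict_pull (m : RigidMotion d) {ε : ℝ} (hε : 0 < ε)
    (D : Set (Space d)) :
    Measure.map (m.pull ε) (volume.restrict (ε • m.image D)) =
      ENNReal.ofReal (ε ^ d) • (volume.restrict D : Measure (Space d)) := by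
  rw [← m.preimage_pull hε, ← (m.measurableEmbedding_pull hε).restrict_map, m.map_pull hε,
    Measure.restrict_smul]

lemma RigidMotion.lintegral_pull (m : RigidMotion d) {ε : ℝ} (hε : 0 < ε)
    (D : Set (Space d)) (g : Space d → ℝ≥0∞) :
    ∫⁻ x in ε • m.image D, g (m.pull ε x) = ENNReal.ofReal (ε ^ d) * ∫⁻ ξ in D, g ξ := by
  rw [← (m.measurableEmbedding_pull hε).lintegral_map, m.map_restrict_pull hε,
    lintegral_smul_measure, smul_eq_mul]

lemma RigidMotion.quasiMeasurePreserving_pull (m : RigidMotion d) {ε : ℝ} (hε : 0 < ε)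
    (D : Set (Space d)) :
    Measure.QuasiMeasurePreserving (m.pull ε) (volume.restrict (ε • m.image D))
      (volume.restrict D) := by
  refine ⟨(m.measurableEmbedding_pull hε).measurable, ?_⟩
  rw [m.map_restrict_pull hε]
  exact Measure.smul_absolutelyContinuous

lemma RigidMotion.volume_smul_image (m : RigidMotion d) {ε : ℝ} (hε : 0 < ε)
    (D : Set (Space d)) :
    volume (ε • m.image D) = ENNReal.ofReal (ε ^ d) * volume D := by
  have := m.lintegral_pull hε D 1
  simpa using this

/-- Translation by `ε y` carries `ε R D` onto the scaled inclusion, whose volume is `ε ^ d |D|`.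
Thus the mean depends on the motion only through the image of `D`. -/
lemma cellMean_eq_average {ε : ℝ} (hε : 0 < ε) (D : Set (Space d)) (m : RigidMotion d)
    (f : Space d → Space d → ℝ) (ξ : Space d) :
    cellMean ε D m f ξ = ⨍ x in ε • m.image D, f x ξ := by
  have hpre : (fun x => ε • m.trans + x) ⁻¹' (ε • m.image D) = ε • (m.rot '' D) := by
    ext x
    rw [mem_preimage, mem_smul_set_iff_inv_smul_mem₀ hε.ne', mem_smul_set_iff_inv_smul_mem₀ hε.ne',
      smul_add, inv_smul_smul₀ hε.ne', RigidMotion.image]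
    simp only [mem_image]
    refine exists_congr fun ξ => and_congr_right fun _ => ?_
    rw [add_comm, add_right_inj]
  have := (measurePreserving_add_left (volume : Measure (Space d))
    (ε • m.trans)).setIntegral_preimage_emb (measurableEmbedding_addLeft _) (fun x => f x ξ)
    (ε • m.image D)
  rw [hpre] at this
  rw [cellMean, this, setAverage_eq, Measure.real, m.volume_smul_image hε, ENNReal.toReal_mul,
    ENNReal.toReal_ofReal (by positivity), smul_eq_mul]

end Geometry

/-! ### A single realization: structure of `π_ε F` and the energy bound. -/

section Realization

variable {d N : ℕ}

/-- The deterministic properties of a typical realization of an inclusion medium. -/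
structure IsGoodRealization (D : Fin N → Set (Space d)) (G : Set (Space d))
    (place : Set (Space d) → RigidMotion d) : Prop where
  isOpen_domain : ∀ j, IsOpen (D j)
  isBounded_domain : ∀ j, Bornology.IsBounded (D j)
  nonempty_domain : ∀ j, (D j).Nonempty
  distinct_domains : ∀ i j, i ≠ j → ¬ IsRigidCopy (D i) (D j)
  components : ∀ x ∈ G, ∃ j, IsRigidCopy (D j) (connectedComponentIn G x)
  placed : ∀ j, ∀ C ∈ cells G (D j), (place C).image (D j) = C

/-- The component `f_j` of a function `F = (f_0, f_1, …, f_N)` on `E`. -/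
def component (F : Space d × Fibre d N → ℝ) (j : Fin N) (p : Space d × Space d) : ℝ :=
  F (p.1, Sum.inr (j, p.2))

/-- The mean of `f(·, ξ)` over `S`. -/
noncomputable def sliceAverage (S : Set (Space d)) (f : Space d × Space d → ℝ) (ξ : Space d) : ℝ :=
  ⨍ x in S, f (x, ξ)

lemma aestronglyMeasurable_sliceAverage (S : Set (Space d)) {ν : Measure (Space d)} [SFinite ν]
    {f : Space d × Space d → ℝ} (hf : AEStronglyMeasurable f (volume.prod ν)) :
    AEStronglyMeasurable (sliceAverage S f) ν := by
  have h1 : AEStronglyMeasurable f ((volume.restrict S).prod ν) :=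
    hf.mono_ac (Measure.restrict_le_self.absolutelyContinuous.prod Measure.AbsolutelyContinuous.rfl)
  have h2 := h1.prod_swap.integral_prod_right'
  have h3 : sliceAverage S f = fun ξ => (volume.real S)⁻¹ • ∫ x in S, f (x, ξ) := by
    ext ξ
    rw [sliceAverage, setAverage_eq]
  rw [h3]
  exact h2.const_smul (volume.real S)⁻¹

lemma ae_ae_swap_of_ae_prod {ν : Measure (Space d)} [SFinite ν] {p : Space d × Space d → Prop}
    (h : ∀ᵐ z ∂(volume : Measure (Space d)).prod ν, p z) :
    ∀ᵐ ξ ∂ν, ∀ᵐ x : Space d, p (x, ξ) :=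
  Measure.ae_ae_of_ae_prod
    (Measure.measurePreserving_swap.quasiMeasurePreserving.tendsto_ae.eventually h)

/-- Jensen's inequality, as the comparison of `L¹` and `L²` norms for the normalised measure on `S`.
-/
lemma volume_mul_enorm_average_sq_le {S : Set (Space d)} (h0 : volume S ≠ 0) (ht : volume S ≠ ∞)
    {g : Space d → ℝ} (hg : AEStronglyMeasurable g (volume.restrict S)) :
    volume S * ‖⨍ x in S, g x‖ₑ ^ 2 ≤ ∫⁻ x in S, ‖g x‖ₑ ^ 2 := by
  have hne : volume.restrict S ≠ 0 := by simpa using h0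
  have hfin : IsFiniteMeasure (volume.restrict S) := ⟨by simpa using ht.lt_top⟩
  have hprob : IsProbabilityMeasure ((volume S)⁻¹ • volume.restrict S) :=
    ⟨by simp [ENNReal.inv_mul_cancel h0 ht]⟩
  have h1 : ‖⨍ x in S, g x‖ₑ ≤ eLpNorm g 2 ((volume S)⁻¹ • volume.restrict S) := by
    rw [average, Measure.restrict_apply_univ]
    refine (enorm_integral_le_lintegral_enorm _).trans ?_
    rw [← eLpNorm_one_eq_lintegral_enorm]
    exact eLpNorm_le_eLpNorm_of_exponent_le (by norm_num)
      (hg.mono_ac Measure.smul_absolutelyContinuous)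
  have h2 := eLpNorm_nnreal_pow_eq_lintegral (μ := (volume S)⁻¹ • volume.restrict S) (f := g)
    (p := 2) two_ne_zero
  rw [lintegral_smul_measure, smul_eq_mul] at h2
  simp only [NNReal.coe_ofNat, ENNReal.coe_ofNat, ENNReal.rpow_ofNat] at h2
  calc volume S * ‖⨍ x in S, g x‖ₑ ^ 2
      ≤ volume S * eLpNorm g 2 ((volume S)⁻¹ • volume.restrict S) ^ 2 := by gcongr
    _ = _ := by rw [h2, ← mul_assoc, ENNReal.mul_inv_cancel h0 ht, one_mul]

namespace IsGoodRealization

variable {D : Fin N → Set (Space d)} {G : Set (Space d)} {place : Set (Space d) → RigidMotion d}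

lemma volume_domain_ne_zero (h : IsGoodRealization D G place) (j : Fin N) : volume (D j) ≠ 0 :=
  ((h.isOpen_domain j).measure_pos volume (h.nonempty_domain j)).ne'

lemma volume_domain_ne_top (h : IsGoodRealization D G place) (j : Fin N) : volume (D j) ≠ ∞ :=
  (h.isBounded_domain j).measure_lt_top.ne

lemma disjoint_copiesIn (h : IsGoodRealization D G place) {i j : Fin N} (hij : i ≠ j) :
    Disjoint (copiesIn G (D i)) (copiesIn G (D j)) :=
  Set.disjoint_left.2 fun _ hx hx' => h.distinct_domains i j hij (hx.2.of_common hx'.2)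

lemma iUnion_copiesIn (h : IsGoodRealization D G place) : ⋃ j, copiesIn G (D j) = G := by
  refine Subset.antisymm (iUnion_subset fun j x hx => hx.1) fun x hx => ?_
  obtain ⟨j, hj⟩ := h.components x hx
  exact mem_iUnion.2 ⟨j, hx, hj⟩

lemma isOpen_medium (h : IsGoodRealization D G place) : IsOpen G := by
  rw [← h.iUnion_copiesIn]
  exact isOpen_iUnion fun j => isOpen_copiesIn (h.isOpen_domain j)

lemma volume_smul_cell (h : IsGoodRealization D G place) {ε : ℝ} (hε : 0 < ε) {j : Fin N}
    {C : Set (Space d)} (hC : C ∈ cells G (D j)) :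
    volume (ε • C) = ENNReal.ofReal (ε ^ d) * volume (D j) := by
  have := (place C).volume_smul_image hε (D j)
  rwa [h.placed j C hC] at this

lemma volume_smul_cell_ne_zero (h : IsGoodRealization D G place) {ε : ℝ} (hε : 0 < ε) {j : Fin N}
    {C : Set (Space d)} (hC : C ∈ cells G (D j)) : volume (ε • C) ≠ 0 := by
  rw [h.volume_smul_cell hε hC]
  have := h.volume_domain_ne_zero j
  have h2 : 0 < ε ^ d := by positivity
  simp [this, h2]

lemma volume_smul_cell_ne_top (h : IsGoodRealization D G place) {ε : ℝ} (hε : 0 < ε) {j : Fin N}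
    {C : Set (Space d)} (hC : C ∈ cells G (D j)) : volume (ε • C) ≠ ∞ := by
  rw [h.volume_smul_cell hε hC]
  exact ENNReal.mul_ne_top ENNReal.ofReal_ne_top (h.volume_domain_ne_top j)

lemma measurableSet_smul_cell (h : IsGoodRealization D G place) {ε : ℝ} (hε : 0 < ε) {j : Fin N}
    {C : Set (Space d)} (hC : C ∈ cells G (D j)) : MeasurableSet (ε • C) :=
  ((isOpen_cell (h.isOpen_domain j) hC).smul₀ hε.ne').measurableSet

lemma biUnion_smul_cells {ε : ℝ} (j : Fin N) :
    ⋃ C ∈ cells G (D j), ε • C = ε • copiesIn G (D j) := by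
  rw [← biUnion_cells, smul_set_iUnion₂]

lemma pairwiseDisjoint_smul_cells {ε : ℝ} (hε : 0 < ε) (j : Fin N) :
    (cells G (D j)).PairwiseDisjoint fun C => ε • C := fun C hC C' hC' hne => by
  have := pairwiseDisjoint_cells G (D j) hC hC' hne
  simp only [Function.onFun, id] at this ⊢
  rw [Set.disjoint_left] at this ⊢
  intro x hx hx'
  rw [mem_smul_set_iff_inv_smul_mem₀ hε.ne'] at hx hx'
  exact this hx hx'

lemma lintegral_smul_copiesIn (h : IsGoodRealization D G place) {ε : ℝ} (hε : 0 < ε) (j : Fin N)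
    (g : Space d → ℝ≥0∞) :
    ∫⁻ x in ε • copiesIn G (D j), g x = ∑' C : cells G (D j), ∫⁻ x in ε • (C : Set (Space d)), g x := by
  rw [← biUnion_smul_cells, lintegral_biUnion (countable_cells (h.isOpen_domain j))
    (fun C hC => h.measurableSet_smul_cell hε hC) (pairwiseDisjoint_smul_cells hε j)]

lemma lintegral_eq_add_sum (h : IsGoodRealization D G place) {ε : ℝ} (hε : 0 < ε)
    (g : Space d → ℝ≥0∞) :
    ∫⁻ x, g x = (∫⁻ x in (ε • G)ᶜ, g x) + ∑ j, ∫⁻ x in ε • copiesIn G (D j), g x := by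
  have hG : MeasurableSet (ε • G) := (h.isOpen_medium.smul₀ hε.ne').measurableSet
  rw [← lintegral_add_compl g hG, add_comm]
  congr 1
  have : ε • G = ⋃ j, ε • copiesIn G (D j) := by
    rw [← smul_set_iUnion, h.iUnion_copiesIn]
  have hdisj : Pairwise (Function.onFun Disjoint fun j => ε • copiesIn G (D j)) := by
    intro i j hij
    have := h.disjoint_copiesIn hij
    simp only [Function.onFun]
    rw [Set.disjoint_left] at this ⊢
    intro x hx hx'
    rw [mem_smul_set_iff_inv_smul_mem₀ hε.ne'] at hx hx'
    exact this hx hx'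
  rw [this, lintegral_iUnion
    (fun j => ((isOpen_copiesIn (h.isOpen_domain j)).smul₀ hε.ne').measurableSet) hdisj,
    tsum_fintype]

lemma cover (h : IsGoodRealization D G place) (ε : ℝ) :
    (univ : Set (Space d)) = (ε • G)ᶜ ∪ ⋃ j, ⋃ C : cells G (D j), ε • (C : Set (Space d)) := by
  have : ⋃ j, ⋃ C : cells G (D j), ε • (C : Set (Space d)) = ε • G := by
    calc _ = ⋃ j, ε • copiesIn G (D j) :=
          iUnion_congr fun j => by rw [← biUnion_smul_cells, biUnion_eq_iUnion]
      _ = ε • G := by rw [← smul_set_iUnion, h.iUnion_copiesIn]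
  rw [this, compl_union_self]

lemma countable_cells' (h : IsGoodRealization D G place) (j : Fin N) :
    Countable (cells G (D j)) := (countable_cells (h.isOpen_domain j)).to_subtype

lemma ae_of_cells (h : IsGoodRealization D G place) (ε : ℝ) {p : Space d → Prop}
    (h0 : ∀ᵐ x ∂volume.restrict (ε • G)ᶜ, p x)
    (h1 : ∀ j, ∀ C ∈ cells G (D j), ∀ᵐ x ∂volume.restrict (ε • C), p x) : ∀ᵐ x, p x := by
  have := h.countable_cells'
  rw [← Measure.restrict_univ (μ := (volume : Measure (Space d))), h.cover ε,
    ae_restrict_union_iff]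
  refine ⟨h0, ?_⟩
  rw [ae_restrict_iUnion_iff]
  intro j
  rw [ae_restrict_iUnion_iff]
  exact fun C => h1 j C C.2

lemma aestronglyMeasurable_of_cells (h : IsGoodRealization D G place) (ε : ℝ) {g : Space d → ℝ}
    (h0 : AEStronglyMeasurable g (volume.restrict (ε • G)ᶜ))
    (h1 : ∀ j, ∀ C ∈ cells G (D j), AEStronglyMeasurable g (volume.restrict (ε • C))) :
    AEStronglyMeasurable g volume := by
  have := h.countable_cells'
  rw [← Measure.restrict_univ (μ := (volume : Measure (Space d))), h.cover ε,
    aestronglyMeasurable_union_iff]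
  exact ⟨h0, .iUnion fun j => .iUnion fun C => h1 j C C.2⟩

lemma piFun_of_mem_cell (h : IsGoodRealization D G place) {ε : ℝ} (hε : 0 < ε) {j : Fin N}
    {C : Set (Space d)} (hC : C ∈ cells G (D j)) (F : Space d × Fibre d N → ℝ) {x : Space d}
    (hx : x ∈ ε • C) :
    piFun D G place ε F x = sliceAverage (ε • C) (component F j) ((place C).pull ε x) := by
  rw [mem_smul_set_iff_inv_smul_mem₀ hε.ne'] at hx
  have hxc := cell_subset_copiesIn hC hx
  -- Only the term of the shape of `C` survives, since the families of different shapes are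
  -- disjoint.
  rw [piFun, if_pos hxc.1, Finset.sum_eq_single j]
  · rw [if_pos hxc, connectedComponentIn_of_mem_cell hC hx, cellMean_eq_average hε,
      h.placed j C hC]
    rfl
  · intro i _ hij
    rw [if_neg fun hxi => Set.disjoint_left.1 (h.disjoint_copiesIn hij) hxi hxc]
  · simp

lemma piFun_of_notMem {ε : ℝ} (hε : 0 < ε) (F : Space d × Fibre d N → ℝ) {x : Space d}
    (hx : x ∉ ε • G) : piFun D G place ε F x = F (x, Sum.inl ()) := by
  rw [mem_smul_set_iff_inv_smul_mem₀ hε.ne'] at hx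
  rw [piFun, if_neg hx]

lemma ae_restrict_compl_piFun (h : IsGoodRealization D G place) {ε : ℝ} (hε : 0 < ε)
    (F : Space d × Fibre d N → ℝ) :
    ∀ᵐ x ∂volume.restrict (ε • G)ᶜ, piFun D G place ε F x = F (x, Sum.inl ()) :=
  (ae_restrict_iff' (h.isOpen_medium.smul₀ hε.ne').measurableSet.compl).2
    (Eventually.of_forall fun _ hx => piFun_of_notMem hε F hx)

lemma ae_restrict_cell_piFun (h : IsGoodRealization D G place) {ε : ℝ} (hε : 0 < ε) {j : Fin N}
    {C : Set (Space d)} (hC : C ∈ cells G (D j)) (F : Space d × Fibre d N → ℝ) :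
    ∀ᵐ x ∂volume.restrict (ε • C), piFun D G place ε F x =
      sliceAverage (ε • C) (component F j) ((place C).pull ε x) :=
  (ae_restrict_iff' (h.measurableSet_smul_cell hε hC)).2
    (Eventually.of_forall fun _ hx => h.piFun_of_mem_cell hε hC F hx)

lemma quasiMeasurePreserving_pull (h : IsGoodRealization D G place) {ε : ℝ} (hε : 0 < ε)
    {j : Fin N} {C : Set (Space d)} (hC : C ∈ cells G (D j)) :
    Measure.QuasiMeasurePreserving ((place C).pull ε) (volume.restrict (ε • C))
      (volume.restrict (D j)) := by
  have := (place C).quasiMeasurePreserving_pull hε (D j)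
  rwa [h.placed j C hC] at this

/-- Independence of the representative: by Fubini the means agree for almost every `ξ`, and `pull`
takes no set of positive measure into a null set. -/
lemma piFun_congr_ae (h : IsGoodRealization D G place) {ε : ℝ} (hε : 0 < ε)
    {F F' : Space d × Fibre d N → ℝ}
    (h0 : ∀ᵐ x, F (x, Sum.inl ()) = F' (x, Sum.inl ()))
    (h1 : ∀ j, component F j =ᵐ[volume.prod (volume.restrict (D j))] component F' j) :
    piFun D G place ε F =ᵐ[volume] piFun D G place ε F' := by
  refine h.ae_of_cells ε ?_ fun j C hC => ?_
  · filter_upwards [h.ae_restrict_compl_piFun hε F, h.ae_restrict_compl_piFun hε F',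
      ae_restrict_of_ae h0] with x h1 h2 h3
    rw [h1, h2, h3]
  · have h2 : ∀ᵐ ξ ∂volume.restrict (D j), sliceAverage (ε • C) (component F j) ξ =
        sliceAverage (ε • C) (component F' j) ξ := by
      filter_upwards [ae_ae_swap_of_ae_prod (h1 j)] with ξ hξ
      exact average_congr (ae_restrict_of_ae hξ)
    filter_upwards [h.ae_restrict_cell_piFun hε hC F, h.ae_restrict_cell_piFun hε hC F',
      (h.quasiMeasurePreserving_pull hε hC).tendsto_ae.eventually h2] with x h3 h4 h5
    rw [h3, h4, h5]

lemma aestronglyMeasurable_piFun (h : IsGoodRealization D G place) {ε : ℝ} (hε : 0 < ε)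
    {F : Space d × Fibre d N → ℝ}
    (h0 : AEStronglyMeasurable (fun x => F (x, Sum.inl ())) volume)
    (h1 : ∀ j, AEStronglyMeasurable (component F j) (volume.prod (volume.restrict (D j)))) :
    AEStronglyMeasurable (piFun D G place ε F) volume := by
  refine h.aestronglyMeasurable_of_cells ε ?_ fun j C hC => ?_
  · exact h0.restrict.congr (EventuallyEq.symm (h.ae_restrict_compl_piFun hε F))
  · exact ((aestronglyMeasurable_sliceAverage (ε • C) (h1 j)).comp_quasiMeasurePreserving
      (h.quasiMeasurePreserving_pull hε hC)).congr
      (EventuallyEq.symm (h.ae_restrict_cell_piFun hε hC F))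

lemma ae_integrableOn_slice (h : IsGoodRealization D G place) {ε : ℝ} (hε : 0 < ε)
    {j : Fin N} {C : Set (Space d)} (hC : C ∈ cells G (D j)) {f : Space d × Space d → ℝ}
    (hf : MemLp f 2 (volume.prod (volume.restrict (D j)))) :
    ∀ᵐ ξ ∂volume.restrict (D j), IntegrableOn (fun x => f (x, ξ)) (ε • C) := by
  have : IsFiniteMeasure (volume.restrict (ε • C)) :=
    ⟨by simpa using (h.volume_smul_cell_ne_top hε hC).lt_top⟩
  have : IsFiniteMeasure (volume.restrict (D j)) :=
    ⟨by simpa using (h.volume_domain_ne_top j).lt_top⟩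
  have hle : (volume.restrict (ε • C)).prod (volume.restrict (D j)) ≤
      volume.prod (volume.restrict (D j)) := Measure.prod_mono Measure.restrict_le_self le_rfl
  exact ((hf.mono_measure hle).integrable (by norm_num)).prod_left_ae

/-- Additivity holds only almost everywhere, as the integral of a nonintegrable slice is `0` by
convention; square integrability makes almost every slice integrable on an inclusion. -/
lemma piFun_add_ae (h : IsGoodRealization D G place) {ε : ℝ} (hε : 0 < ε)
    {F F' : Space d × Fibre d N → ℝ}
    (hF : ∀ j, MemLp (component F j) 2 (volume.prod (volume.restrict (D j))))
    (hF' : ∀ j, MemLp (component F' j) 2 (volume.prod (volume.restrict (D j)))) :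
    piFun D G place ε (F + F') =ᵐ[volume] piFun D G place ε F + piFun D G place ε F' := by
  refine h.ae_of_cells ε ?_ fun j C hC => ?_
  · filter_upwards [h.ae_restrict_compl_piFun hε F, h.ae_restrict_compl_piFun hε F',
      h.ae_restrict_compl_piFun hε (F + F')] with x h1 h2 h3
    rw [h3, Pi.add_apply, Pi.add_apply, h1, h2]
  · have h2 : ∀ᵐ ξ ∂volume.restrict (D j), sliceAverage (ε • C) (component (F + F') j) ξ =
        sliceAverage (ε • C) (component F j) ξ + sliceAverage (ε • C) (component F' j) ξ := by
      filter_upwards [h.ae_integrableOn_slice hε hC (hF j),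
        h.ae_integrableOn_slice hε hC (hF' j)] with ξ h3 h4
      simp only [sliceAverage, setAverage_eq]
      rw [← smul_add, ← integral_add h3 h4]
      rfl
    filter_upwards [h.ae_restrict_cell_piFun hε hC F, h.ae_restrict_cell_piFun hε hC F',
      h.ae_restrict_cell_piFun hε hC (F + F'),
      (h.quasiMeasurePreserving_pull hε hC).tendsto_ae.eventually h2] with x h3 h4 h5 h6
    rw [h5, h6, Pi.add_apply, h3, h4]

lemma piFun_smul_ae (h : IsGoodRealization D G place) {ε : ℝ} (hε : 0 < ε)
    (c : ℝ) (F : Space d × Fibre d N → ℝ) :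
    piFun D G place ε (c • F) =ᵐ[volume] c • piFun D G place ε F := by
  refine h.ae_of_cells ε ?_ fun j C hC => ?_
  · filter_upwards [h.ae_restrict_compl_piFun hε F, h.ae_restrict_compl_piFun hε (c • F)]
      with x h1 h2
    rw [h2, Pi.smul_apply, Pi.smul_apply, h1]
  · filter_upwards [h.ae_restrict_cell_piFun hε hC F, h.ae_restrict_cell_piFun hε hC (c • F)]
      with x h1 h2
    rw [h2, Pi.smul_apply, h1]
    simp only [sliceAverage, setAverage_eq]
    rw [smul_comm, ← integral_smul c]
    rfl

/-- The Jacobian `ε ^ d` equals `|ε C| / |D_j|`. Writing it as an integral of a constant over `ε C`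
gives the shape of the energy of `f_j`, ready for comparison under the integral. -/
lemma lintegral_cell_piFun (h : IsGoodRealization D G place) {ε : ℝ} (hε : 0 < ε) {j : Fin N}
    {C : Set (Space d)} (hC : C ∈ cells G (D j)) (F : Space d × Fibre d N → ℝ) :
    ∫⁻ x in ε • C, ‖piFun D G place ε F x‖ₑ ^ 2 = (volume (D j))⁻¹ *
      ∫⁻ _ in ε • C, ∫⁻ ξ in D j, ‖sliceAverage (ε • C) (component F j) ξ‖ₑ ^ 2 := by
  have h1 : ∫⁻ x in ε • C, ‖piFun D G place ε F x‖ₑ ^ 2 =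
      ∫⁻ x in ε • C, ‖sliceAverage (ε • C) (component F j) ((place C).pull ε x)‖ₑ ^ 2 := by
    refine lintegral_congr_ae ?_
    filter_upwards [h.ae_restrict_cell_piFun hε hC F] with x hx
    rw [hx]
  have h2 := (place C).lintegral_pull hε (D j)
    (fun ξ => ‖sliceAverage (ε • C) (component F j) ξ‖ₑ ^ 2)
  rw [h.placed j C hC] at h2
  rw [h1, h2, lintegral_const, Measure.restrict_apply_univ, h.volume_smul_cell hε hC]
  have := ENNReal.inv_mul_cancel (h.volume_domain_ne_zero j) (h.volume_domain_ne_top j)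
  calc _ = 1 * (∫⁻ ξ in D j, ‖sliceAverage (ε • C) (component F j) ξ‖ₑ ^ 2) *
        ENNReal.ofReal (ε ^ d) := by rw [one_mul, mul_comm]
    _ = _ := by rw [← this]; ring

lemma lintegral_cell_piFun_le (h : IsGoodRealization D G place) {ε : ℝ} (hε : 0 < ε) {j : Fin N}
    {C : Set (Space d)} (hC : C ∈ cells G (D j)) {F : Space d × Fibre d N → ℝ}
    (hF : AEStronglyMeasurable (component F j) (volume.prod (volume.restrict (D j)))) :
    ∫⁻ x in ε • C, ‖piFun D G place ε F x‖ₑ ^ 2 ≤ (volume (D j))⁻¹ *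
      ∫⁻ x in ε • C, ∫⁻ ξ in D j, ‖component F j (x, ξ)‖ₑ ^ 2 := by
  rw [h.lintegral_cell_piFun hε hC]
  refine mul_le_mul_right ?_ _
  have hFC : AEStronglyMeasurable (component F j)
      ((volume.restrict (ε • C)).prod (volume.restrict (D j))) :=
    hF.mono_ac (Measure.restrict_le_self.absolutelyContinuous.prod Measure.AbsolutelyContinuous.rfl)
  -- With `ξ` outermost, Jensen's inequality applies to each slice.
  rw [lintegral_const, Measure.restrict_apply_univ, mul_comm,
    ← lintegral_const_mul' _ _ (h.volume_smul_cell_ne_top hε hC),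
    lintegral_lintegral_swap (f := fun x ξ => ‖component F j (x, ξ)‖ₑ ^ 2) (hFC.enorm.pow_const 2)]
  refine lintegral_mono_ae ?_
  filter_upwards [hFC.prod_swap.prodMk_left] with ξ hξ
  exact volume_mul_enorm_average_sq_le (h.volume_smul_cell_ne_zero hε hC)
    (h.volume_smul_cell_ne_top hε hC) hξ

lemma lintegral_compl_piFun (h : IsGoodRealization D G place) {ε : ℝ} (hε : 0 < ε)
    (F : Space d × Fibre d N → ℝ) :
    ∫⁻ x in (ε • G)ᶜ, ‖piFun D G place ε F x‖ₑ ^ 2 =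
      ∫⁻ x in (ε • G)ᶜ, ‖F (x, Sum.inl ())‖ₑ ^ 2 := by
  refine lintegral_congr_ae ?_
  filter_upwards [h.ae_restrict_compl_piFun hε F] with x hx
  rw [hx]

lemma lintegral_piFun_le (h : IsGoodRealization D G place) {ε : ℝ} (hε : 0 < ε)
    {F : Space d × Fibre d N → ℝ}
    (hF : ∀ j, AEStronglyMeasurable (component F j) (volume.prod (volume.restrict (D j)))) :
    ∫⁻ x, ‖piFun D G place ε F x‖ₑ ^ 2 ≤ (∫⁻ x, ‖F (x, Sum.inl ())‖ₑ ^ 2) +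
      ∑ j, (volume (D j))⁻¹ * ∫⁻ x, ∫⁻ ξ in D j, ‖component F j (x, ξ)‖ₑ ^ 2 := by
  rw [h.lintegral_eq_add_sum hε]
  refine add_le_add ?_ (Finset.sum_le_sum ?_)
  · rw [h.lintegral_compl_piFun hε]
    exact setLIntegral_le_lintegral _ _
  · intro j _
    rw [h.lintegral_smul_copiesIn hε]
    calc ∑' C : cells G (D j), ∫⁻ x in ε • (C : Set (Space d)), ‖piFun D G place ε F x‖ₑ ^ 2
        ≤ ∑' C : cells G (D j), (volume (D j))⁻¹ *
          ∫⁻ x in ε • (C : Set (Space d)), ∫⁻ ξ in D j, ‖component F j (x, ξ)‖ₑ ^ 2 :=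
          ENNReal.tsum_le_tsum fun C => h.lintegral_cell_piFun_le hε C.2 (hF j)
      _ = (volume (D j))⁻¹ *
          ∫⁻ x in ε • copiesIn G (D j), ∫⁻ ξ in D j, ‖component F j (x, ξ)‖ₑ ^ 2 := by
          rw [ENNReal.tsum_mul_left, ← h.lintegral_smul_copiesIn hε]
      _ ≤ _ := by
          gcongr
          exact Measure.restrict_le_self

end IsGoodRealization

end Realization

/-! ### The measure on `E` and the bounded operator on `L²(E, α)`. -/

section Operator

variable {d N : ℕ} {Ω : Type*} [MeasurableSpace Ω] {P : Measure Ω}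
  {D : Fin N → Set (Space d)} {G : Ω → Set (Space d)}

lemma measurableEmbedding_inl :
    MeasurableEmbedding fun x : Space d => ((x, Sum.inl ()) : Space d × Fibre d N) := by
  refine MeasurableEmbedding.of_measurable_inverse (g := Prod.fst) (by fun_prop) ?_
    measurable_fst fun _ => rfl
  have : range (fun x : Space d => ((x, Sum.inl ()) : Space d × Fibre d N)) =
      univ ×ˢ range Sum.inl := by
    ext ⟨x, y⟩
    rcases y with ⟨⟩ | y <;> simp
  rw [this]
  exact MeasurableSet.univ.prod measurableSet_range_inl

lemma measurableEmbedding_fibre (j : Fin N) :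
    MeasurableEmbedding fun ξ : Space d => (Sum.inr (j, ξ) : Fibre d N) :=
  MeasurableEmbedding.comp (g := Sum.inr)
    ⟨Sum.inr_injective, measurable_inr, fun _ hs => measurableSet_inr_image.2 hs⟩
    (measurableEmbedding_prodMk_left j)

lemma measurableEmbedding_inr (j : Fin N) :
    MeasurableEmbedding fun z : Space d × Space d =>
      ((z.1, Sum.inr (j, z.2)) : Space d × Fibre d N) :=
  MeasurableEmbedding.id.prodMap (measurableEmbedding_fibre j)

lemma sFinite_finset_sum {β ι : Type*} [MeasurableSpace β] (s : Finset ι) (ν : ι → Measure β)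
    [∀ i, SFinite (ν i)] : SFinite (∑ i ∈ s, ν i) := by
  classical
  induction s using Finset.induction_on with
  | empty => rw [Finset.sum_empty]; infer_instance
  | insert i s hi ih =>
    rw [Finset.sum_insert hi]
    infer_instance

lemma prod_finset_sum {α β ι : Type*} [MeasurableSpace α] [MeasurableSpace β] (μ : Measure α)
    [SFinite μ] (s : Finset ι) (ν : ι → Measure β) [∀ i, SFinite (ν i)] :
    μ.prod (∑ i ∈ s, ν i) = ∑ i ∈ s, μ.prod (ν i) := by
  classical
  induction s using Finset.induction_on with
  | empty => simp
  | insert i s hi ih =>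
    have : SFinite (∑ i ∈ s, ν i) := sFinite_finset_sum s ν
    rw [Finset.sum_insert hi, Finset.sum_insert hi, Measure.prod_add, ih]

lemma measureE_eq (P : Measure Ω) (D : Fin N → Set (Space d)) (G : Ω → Set (Space d)) :
    measureE P D G = alphaZero P G • volume.map (fun x : Space d => (x, Sum.inl ())) +
      ∑ j, alpha P D G j • (volume.prod (volume.restrict (D j))).map
        (fun z : Space d × Space d => (z.1, Sum.inr (j, z.2))) := by
  have h1 : ∀ j : Fin N, SFinite (alpha P D G j •
      (volume.restrict (D j)).map fun ξ => (Sum.inr (j, ξ) : Fibre d N)) := inferInstance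
  have h3 := sFinite_finset_sum Finset.univ fun j : Fin N => alpha P D G j •
    (volume.restrict (D j)).map fun ξ => (Sum.inr (j, ξ) : Fibre d N)
  rw [measureE, fibreMeasure, Measure.prod_add, Measure.prod_smul_right, Measure.prod_dirac,
    prod_finset_sum]
  congr 2 with j : 1
  rw [Measure.prod_smul_right]
  congr 1
  have h2 := Measure.map_prod_map (volume : Measure (Space d)) (volume.restrict (D j))
    measurable_id (measurableEmbedding_fibre (N := N) j).measurable
  rw [Measure.map_id] at h2
  exact h2

lemma lintegral_measureE (P : Measure Ω) (D : Fin N → Set (Space d)) (G : Ω → Set (Space d))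
    (g : Space d × Fibre d N → ℝ≥0∞) :
    ∫⁻ z, g z ∂measureE P D G = alphaZero P G * (∫⁻ x, g (x, Sum.inl ())) +
      ∑ j, alpha P D G j *
        ∫⁻ z, g (z.1, Sum.inr (j, z.2)) ∂(volume.prod (volume.restrict (D j))) := by
  rw [measureE_eq, lintegral_add_measure, lintegral_finsetSum_measure, lintegral_smul_measure,
    measurableEmbedding_inl.lintegral_map, smul_eq_mul]
  congr 2 with j
  rw [lintegral_smul_measure, (measurableEmbedding_inr j).lintegral_map, smul_eq_mul]

/-- Here positivity of `α_0` enters (that of `α_j` in `map_inr_le`): null sets and square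
integrability on `E` pass to the components. -/
lemma map_inl_le (hα₀ : alphaZero P G ≠ 0) (hα₀' : alphaZero P G ≠ ∞) :
    volume.map (fun x : Space d => (x, Sum.inl ())) ≤
      (alphaZero P G)⁻¹ • measureE P D G := by
  rw [measureE_eq, smul_add, smul_smul, ENNReal.inv_mul_cancel hα₀ hα₀', one_smul]
  exact Measure.le_add_right le_rfl

lemma map_inr_le {j : Fin N} (hα : alpha P D G j ≠ 0) (hα' : alpha P D G j ≠ ∞) :
    (volume.prod (volume.restrict (D j))).map
      (fun z : Space d × Space d => (z.1, (Sum.inr (j, z.2) : Fibre d N))) ≤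
      (alpha P D G j)⁻¹ • measureE P D G := by
  rw [measureE_eq, smul_add]
  refine Measure.le_add_left ?_
  rw [Finset.smul_sum, ← Finset.add_sum_erase _ _ (Finset.mem_univ j)]
  refine Measure.le_add_right (le_of_eq ?_)
  rw [smul_smul, ENNReal.inv_mul_cancel hα hα', one_smul]

lemma memLp_inl (hα₀ : alphaZero P G ≠ 0) (hα₀' : alphaZero P G ≠ ∞)
    {F : Space d × Fibre d N → ℝ} (hF : MemLp F 2 (measureE P D G)) :
    MemLp (fun x => F (x, Sum.inl ())) 2 volume :=
  (hF.of_measure_le_smul (ENNReal.inv_ne_top.2 hα₀) (map_inl_le hα₀ hα₀')).comp_of_map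
    measurableEmbedding_inl.measurable.aemeasurable

lemma memLp_component {j : Fin N} (hα : alpha P D G j ≠ 0) (hα' : alpha P D G j ≠ ∞)
    {F : Space d × Fibre d N → ℝ} (hF : MemLp F 2 (measureE P D G)) :
    MemLp (component F j) 2 (volume.prod (volume.restrict (D j))) :=
  (hF.of_measure_le_smul (ENNReal.inv_ne_top.2 hα) (map_inr_le hα hα')).comp_of_map
    (measurableEmbedding_inr j).measurable.aemeasurable

lemma ae_inl (hα₀ : alphaZero P G ≠ 0) (hα₀' : alphaZero P G ≠ ∞)
    {F F' : Space d × Fibre d N → ℝ} (hF : F =ᵐ[measureE P D G] F') :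
    ∀ᵐ x, F (x, Sum.inl ()) = F' (x, Sum.inl ()) :=
  ae_of_ae_map measurableEmbedding_inl.measurable.aemeasurable
    ((Measure.absolutelyContinuous_of_le_smul (map_inl_le hα₀ hα₀')).ae_le hF)

lemma ae_component {j : Fin N} (hα : alpha P D G j ≠ 0) (hα' : alpha P D G j ≠ ∞)
    {F F' : Space d × Fibre d N → ℝ} (hF : F =ᵐ[measureE P D G] F') :
    component F j =ᵐ[volume.prod (volume.restrict (D j))] component F' j :=
  ae_of_ae_map (measurableEmbedding_inr j).measurable.aemeasurable
    ((Measure.absolutelyContinuous_of_le_smul (map_inr_le hα hα')).ae_le hF)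

lemma eLpNorm_two_sq {α : Type*} [MeasurableSpace α] (μ : Measure α) (f : α → ℝ) :
    eLpNorm f 2 μ ^ 2 = ∫⁻ x, ‖f x‖ₑ ^ 2 ∂μ := by
  have := eLpNorm_nnreal_pow_eq_lintegral (μ := μ) (f := f) (p := 2) two_ne_zero
  simpa only [NNReal.coe_ofNat, ENNReal.coe_ofNat, ENNReal.rpow_ofNat] using this

/-- The square of the norm bound of the operators `π_ε`. -/
noncomputable def boundSq (P : Measure Ω) (D : Fin N → Set (Space d))
    (G : Ω → Set (Space d)) : ℝ≥0∞ :=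
  (alphaZero P G)⁻¹ + ∑ j, (volume (D j))⁻¹ * (alpha P D G j)⁻¹

lemma inv_mul_le_of_mul_le {a b c : ℝ≥0∞} (ha : a ≠ 0) (ha' : a ≠ ∞) (h : a * b ≤ c) :
    b ≤ a⁻¹ * c := by
  rwa [← ENNReal.mul_le_mul_iff_right ha ha', ← mul_assoc, ENNReal.mul_inv_cancel ha ha', one_mul]

variable {G₀ : Set (Space d)} {place : Set (Space d) → RigidMotion d}

lemma IsGoodRealization.lintegral_piFun_le_boundSq (h : IsGoodRealization D G₀ place)
    (hα₀ : alphaZero P G ≠ 0) (hα₀' : alphaZero P G ≠ ∞) (hα : ∀ j, alpha P D G j ≠ 0)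
    (hα' : ∀ j, alpha P D G j ≠ ∞) {ε : ℝ} (hε : 0 < ε) {F : Space d × Fibre d N → ℝ}
    (hF : MemLp F 2 (measureE P D G)) :
    ∫⁻ x, ‖piFun D G₀ place ε F x‖ₑ ^ 2 ≤
      boundSq P D G * ∫⁻ z, ‖F z‖ₑ ^ 2 ∂measureE P D G := by
  have hm := fun j => (memLp_component (hα j) (hα' j) hF).aestronglyMeasurable
  have hE := lintegral_measureE P D G (fun z => ‖F z‖ₑ ^ 2)
  refine (h.lintegral_piFun_le hε hm).trans ?_
  rw [boundSq, add_mul, Finset.sum_mul]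
  refine add_le_add ?_ (Finset.sum_le_sum fun j _ => ?_)
  · refine inv_mul_le_of_mul_le hα₀ hα₀' ?_
    rw [hE]
    exact le_self_add
  · rw [mul_assoc]
    gcongr
    refine inv_mul_le_of_mul_le (hα j) (hα' j) ?_
    rw [hE]
    refine le_trans ?_ le_add_self
    refine le_trans (le_of_eq ?_) (Finset.single_le_sum (fun _ _ => zero_le) (Finset.mem_univ j))
    congr 1
    exact (lintegral_prod (fun z : Space d × Space d => ‖component F j z‖ₑ ^ 2)
      ((hm j).enorm.pow_const 2)).symm

lemma IsGoodRealization.boundSq_ne_top (h : IsGoodRealization D G₀ place)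
    (hα₀ : alphaZero P G ≠ 0) (hα : ∀ j, alpha P D G j ≠ 0) : boundSq P D G ≠ ∞ := by
  refine ENNReal.add_ne_top.2 ⟨ENNReal.inv_ne_top.2 hα₀, ENNReal.sum_ne_top.2 fun j _ => ?_⟩
  exact ENNReal.mul_ne_top (ENNReal.inv_ne_top.2 (h.volume_domain_ne_zero j))
    (ENNReal.inv_ne_top.2 (hα j))

lemma IsGoodRealization.memLp_piFun (h : IsGoodRealization D G₀ place)
    (hα₀ : alphaZero P G ≠ 0) (hα₀' : alphaZero P G ≠ ∞) (hα : ∀ j, alpha P D G j ≠ 0)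
    (hα' : ∀ j, alpha P D G j ≠ ∞) {ε : ℝ} (hε : 0 < ε) {F : Space d × Fibre d N → ℝ}
    (hF : MemLp F 2 (measureE P D G)) : MemLp (piFun D G₀ place ε F) 2 volume := by
  refine ⟨h.aestronglyMeasurable_piFun hε (memLp_inl hα₀ hα₀' hF).aestronglyMeasurable
    fun j => (memLp_component (hα j) (hα' j) hF).aestronglyMeasurable, ?_⟩
  have hb := h.boundSq_ne_top hα₀ hα
  have h1 := h.lintegral_piFun_le_boundSq hα₀ hα₀' hα hα' hε hF
  rw [← eLpNorm_two_sq, ← eLpNorm_two_sq] at h1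
  have h2 := h1.trans_lt (ENNReal.mul_lt_top hb.lt_top (ENNReal.pow_lt_top hF.2))
  by_contra hcon
  rw [not_lt, top_le_iff] at hcon
  simp [hcon] at h2

/-- For a good realization, `piFun` induces a bounded linear operator `L²(E, α) → L²(ℝ^d)`. -/
lemma IsGoodRealization.exists_operator (h : IsGoodRealization D G₀ place)
    (hα₀ : alphaZero P G ≠ 0) (hα₀' : alphaZero P G ≠ ∞) (hα : ∀ j, alpha P D G j ≠ 0)
    (hα' : ∀ j, alpha P D G j ≠ ∞) {ε : ℝ} (hε : 0 < ε) :
    ∃ T : L2E P D G →L[ℝ] L2 d,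
      (∀ (f : Space d × Fibre d N → ℝ) (hf : MemLp f 2 (measureE P D G)),
        T (hf.toLp f) =ᵐ[volume] piFun D G₀ place ε f) ∧
      ∀ F, ‖T F‖ ≤ √(boundSq P D G).toReal * ‖F‖ := by
  have hb := h.boundSq_ne_top hα₀ hα
  have hmem : ∀ F : L2E P D G, MemLp (piFun D G₀ place ε F) 2 volume := fun F =>
    h.memLp_piFun hα₀ hα₀' hα hα' hε (Lp.memLp F)
  have hcongr : ∀ {F F' : Space d × Fibre d N → ℝ}, F =ᵐ[measureE P D G] F' →
      piFun D G₀ place ε F =ᵐ[volume] piFun D G₀ place ε F' := fun hFF' =>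
    h.piFun_congr_ae hε (ae_inl hα₀ hα₀' hFF') fun j => ae_component (hα j) (hα' j) hFF'
  let T₀ : L2E P D G →ₗ[ℝ] L2 d :=
    { toFun := fun F => (hmem F).toLp _
      map_add' := fun F F' => by
        rw [← MemLp.toLp_add, MemLp.toLp_eq_toLp_iff]
        exact (hcongr (Lp.coeFn_add F F')).trans (h.piFun_add_ae hε
          (fun j => memLp_component (hα j) (hα' j) (Lp.memLp F))
          (fun j => memLp_component (hα j) (hα' j) (Lp.memLp F')))
      map_smul' := fun c F => by
        rw [RingHom.id_apply, ← MemLp.toLp_const_smul, MemLp.toLp_eq_toLp_iff]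
        exact (hcongr (Lp.coeFn_smul c F)).trans (h.piFun_smul_ae hε c F) }
  have hbound : ∀ F, ‖T₀ F‖ ≤ √(boundSq P D G).toReal * ‖F‖ := by
    intro F
    have h1 := h.lintegral_piFun_le_boundSq hα₀ hα₀' hα hα' hε (Lp.memLp F)
    rw [← eLpNorm_two_sq, ← eLpNorm_two_sq] at h1
    have h2 := ENNReal.toReal_mono (ENNReal.mul_ne_top hb
      (ENNReal.pow_ne_top (Lp.memLp F).2.ne)) h1
    rw [ENNReal.toReal_mul, ENNReal.toReal_pow, ENNReal.toReal_pow] at h2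
    have h3 : ‖T₀ F‖ = (eLpNorm (piFun D G₀ place ε F) 2 volume).toReal := Lp.norm_toLp _ (hmem F)
    rw [h3, Lp.norm_def]
    refine le_of_sq_le_sq ?_ (by positivity)
    rwa [mul_pow, Real.sq_sqrt ENNReal.toReal_nonneg]
  refine ⟨T₀.mkContinuous _ hbound, fun f hf => ?_, hbound⟩
  exact (hmem _).coeFn_toLp.trans (hcongr hf.coeFn_toLp)

end Operator

/-! ### Replacing means by values for continuous compactly supported functions. -/

section Convergence

open Metric

variable {d N : ℕ}

lemma enorm_sq_le_add {a b K t κ : ℝ} (ha : |a| ≤ K) (hb : |b| ≤ K) (hab : |a - b| ≤ t)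
    (ht : 2 * K * t ≤ κ) : ‖a‖ₑ ^ 2 ≤ ‖b‖ₑ ^ 2 + ENNReal.ofReal κ := by
  have h0 : 0 ≤ t := (abs_nonneg _).trans hab
  have hK : 0 ≤ K := (abs_nonneg _).trans ha
  rw [Real.enorm_eq_ofReal_abs, Real.enorm_eq_ofReal_abs, ← ENNReal.ofReal_pow (abs_nonneg _),
    ← ENNReal.ofReal_pow (abs_nonneg _), sq_abs, sq_abs,
    ← ENNReal.ofReal_add (sq_nonneg _) ((by positivity : 0 ≤ 2 * K * t).trans ht)]
  refine ENNReal.ofReal_le_ofReal ?_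
  have h1 : a ^ 2 - b ^ 2 ≤ |a - b| * |a + b| := by
    rw [← abs_mul]
    exact (le_abs_self _).trans_eq' (by ring)
  have h2 : |a + b| ≤ 2 * K := (abs_add_le a b).trans (by linarith)
  have h3 : |a - b| * |a + b| ≤ t * (2 * K) := mul_le_mul hab h2 (abs_nonneg _) h0
  linarith

/-- A mean lies in any closed ball containing the values, so uniform continuity controls its
distance to `f (x, ξ)`. The error is confined to a fixed ball of `x`, which makes its total over all
inclusions finite. -/
lemma exists_forall_sliceAverage_near {f : Space d × Space d → ℝ} (hf : Continuous f)
    (hf' : HasCompactSupport f) :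
    ∃ ρ : ℝ, ∀ κ > 0, ∃ r > 0, ∀ S : Set (Space d), volume S ≠ 0 → volume S ≠ ∞ →
      MeasurableSet S → (∀ x ∈ S, ∀ y ∈ S, dist x y ≤ r) → ∀ x ∈ S, ∀ ξ,
      ‖sliceAverage S f ξ‖ₑ ^ 2 ≤ ‖f (x, ξ)‖ₑ ^ 2 +
        (ball 0 ρ).indicator (fun _ => ENNReal.ofReal κ) x ∧
      ‖f (x, ξ)‖ₑ ^ 2 ≤ ‖sliceAverage S f ξ‖ₑ ^ 2 +
        (ball 0 ρ).indicator (fun _ => ENNReal.ofReal κ) x := by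
  obtain ⟨K, hK⟩ := hf.bounded_above_of_compact_support hf'
  have hK0 : 0 ≤ K := (norm_nonneg _).trans (hK 0)
  obtain ⟨ρ, hρ⟩ := hf'.isCompact.isBounded.subset_ball 0
  have hout : ∀ x ξ, ρ ≤ ‖x‖ → f (x, ξ) = 0 := fun x ξ hx => by
    by_contra hne
    have h1 := hρ (subset_tsupport f hne)
    rw [mem_ball_zero_iff, Prod.norm_def] at h1
    exact absurd (lt_of_le_of_lt (le_max_left _ _) h1) (not_lt.2 hx)
  refine ⟨ρ + 1, fun κ hκ => ?_⟩
  have hδ : 0 < κ / (2 * K + 1) := by positivity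
  obtain ⟨r, hr0, hr⟩ := Metric.uniformContinuous_iff.1
    (hf.uniformContinuous_of_tendsto_cocompact hf'.is_zero_at_infty) _ hδ
  -- The half gives strict inequality in uniform continuity; the `1` keeps a set `S` that contains a
  -- point outside the ball of radius `ρ + 1` away from the support, where the error is exactly `0`.
  refine ⟨min (r / 2) 1, by positivity, fun S h0 ht hS hdist x hx ξ => ?_⟩
  have hfin : IsFiniteMeasure (volume.restrict S) := ⟨by simpa using ht.lt_top⟩
  have hint : IntegrableOn (fun y => f (y, ξ)) S :=
    Integrable.of_bound (by fun_prop : Continuous fun y => f (y, ξ)).aestronglyMeasurable K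
      (Eventually.of_forall fun _ => hK _)
  have hmem : ∀ (b t : ℝ), (∀ y ∈ S, |f (y, ξ) - b| ≤ t) → |sliceAverage S f ξ - b| ≤ t := by
    intro b t hbt
    have := (convex_closedBall b t).set_average_mem isClosed_closedBall h0 ht
      ((ae_restrict_iff' hS).2 (Eventually.of_forall fun y hy =>
        mem_closedBall.2 ((Real.dist_eq _ _).trans_le (hbt y hy)))) hint
    simpa [Real.dist_eq, sliceAverage] using this
  have hA : |sliceAverage S f ξ| ≤ K := by
    simpa using hmem 0 K fun y _ => by simpa using hK (y, ξ)
  have hb : |f (x, ξ)| ≤ K := hK (x, ξ)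
  by_cases hxB : x ∈ ball (0 : Space d) (ρ + 1)
  · have hab := hmem (f (x, ξ)) (κ / (2 * K + 1)) fun y hy => by
      have hd : dist (y, ξ) (x, ξ) < r := by
        rw [Prod.dist_eq, dist_self, max_eq_left dist_nonneg]
        exact ((hdist y hy x hx).trans (min_le_left _ _)).trans_lt (by linarith)
      exact ((Real.dist_eq _ _).symm.trans_lt (hr hd)).le
    have hκ' : 2 * K * (κ / (2 * K + 1)) ≤ κ := by
      rw [mul_div_assoc', div_le_iff₀ (by positivity)]
      nlinarith
    rw [indicator_of_mem hxB]
    exact ⟨enorm_sq_le_add hA hb hab hκ', enorm_sq_le_add hb hA (by rwa [abs_sub_comm]) hκ'⟩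
  · rw [mem_ball_zero_iff, not_lt] at hxB
    have hab := hmem (f (x, ξ)) 0 fun y hy => by
      have h1 := (hdist x hx y hy).trans (min_le_right _ _)
      rw [dist_eq_norm] at h1
      have h2 := norm_sub_norm_le x y
      rw [hout x ξ (by linarith), hout y ξ (by linarith)]
      simp
    have : sliceAverage S f ξ = f (x, ξ) := sub_eq_zero.1 (abs_nonpos_iff.1 hab)
    rw [this]
    exact ⟨le_self_add, le_self_add⟩

/-- The error does not depend on `ξ`, so its integral over `D` produces a factor `|D|` that cancels
the prefactor. -/
lemma inv_mul_lintegral_le_add {S D : Set (Space d)} (hS : MeasurableSet S)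
    (hD0 : volume D ≠ 0) (hD : volume D ≠ ∞) {u v : Space d → Space d → ℝ≥0∞} {e : Space d → ℝ≥0∞}
    (he : Measurable e) (h : ∀ x ∈ S, ∀ ξ, u x ξ ≤ v x ξ + e x) :
    (volume D)⁻¹ * ∫⁻ x in S, ∫⁻ ξ in D, u x ξ ≤
      (volume D)⁻¹ * (∫⁻ x in S, ∫⁻ ξ in D, v x ξ) + ∫⁻ x in S, e x := by
  have h1 : ∫⁻ x in S, ∫⁻ ξ in D, u x ξ ≤
      (∫⁻ x in S, ∫⁻ ξ in D, v x ξ) + (∫⁻ x in S, e x) * volume D := by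
    rw [← lintegral_mul_const _ he, ← lintegral_add_right _ (he.mul_const _)]
    refine setLIntegral_mono' hS fun x hx => ?_
    refine (lintegral_mono (h x hx)).trans ?_
    rw [lintegral_add_right _ measurable_const]
    simp
  refine (mul_le_mul_right h1 _).trans (le_of_eq ?_)
  rw [mul_add, mul_comm _ (volume D), ← mul_assoc, ENNReal.inv_mul_cancel hD0 hD, one_mul]

lemma tendsto_of_eventually_le_add {ι : Type*} {l : Filter ι} {X Y : ι → ℝ≥0∞} {a : ℝ≥0∞}
    (ha : a ≠ ∞) (hY : Tendsto Y l (𝓝 a))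
    (h : ∀ κ : ℝ, 0 < κ → ∀ᶠ i in l, X i ≤ Y i + ENNReal.ofReal κ ∧ Y i ≤ X i + ENNReal.ofReal κ) :
    Tendsto X l (𝓝 a) := by
  rw [ENNReal.tendsto_nhds ha] at hY ⊢
  intro η hη
  rcases eq_or_ne η ∞ with rfl | hηt
  · exact Eventually.of_forall fun i => ⟨by simp, by simp⟩
  have hη' : 0 < η.toReal := ENNReal.toReal_pos hη.ne' hηt
  have hhalf : ENNReal.ofReal (η.toReal / 2) + ENNReal.ofReal (η.toReal / 2) = η := by
    rw [← ENNReal.ofReal_add (by positivity) (by positivity), add_halves, ENNReal.ofReal_toReal hηt]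
  filter_upwards [hY (ENNReal.ofReal (η.toReal / 2)) (by simpa using hη'), h _ (half_pos hη')]
    with i h1 h2
  constructor
  · rw [tsub_le_iff_right]
    calc a ≤ Y i + ENNReal.ofReal (η.toReal / 2) := tsub_le_iff_right.1 h1.1
      _ ≤ X i + ENNReal.ofReal (η.toReal / 2) + ENNReal.ofReal (η.toReal / 2) := by
          gcongr; exact h2.2
      _ = X i + η := by rw [add_assoc, hhalf]
  · calc X i ≤ Y i + ENNReal.ofReal (η.toReal / 2) := h2.1
      _ ≤ a + ENNReal.ofReal (η.toReal / 2) + ENNReal.ofReal (η.toReal / 2) := by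
          gcongr; exact h1.2
      _ = a + η := by rw [add_assoc, hhalf]

variable {D : Fin N → Set (Space d)} {G : Set (Space d)} {place : Set (Space d) → RigidMotion d}

lemma IsGoodRealization.dist_le_of_mem_smul_cell (h : IsGoodRealization D G place) {ε : ℝ}
    (hε : 0 < ε) {j : Fin N} {C : Set (Space d)} (hC : C ∈ cells G (D j)) {x y : Space d}
    (hx : x ∈ ε • C) (hy : y ∈ ε • C) : dist x y ≤ ε * diam (D j) := by
  rw [← h.placed j C hC] at hx hy
  obtain ⟨_, ⟨ξ, hξ, rfl⟩, rfl⟩ := hx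
  obtain ⟨_, ⟨η, hη, rfl⟩, rfl⟩ := hy
  simp only [dist_smul₀, dist_add_right, LinearIsometryEquiv.dist_map, Real.norm_eq_abs,
    abs_of_pos hε]
  gcongr
  exact dist_le_diam_of_mem (h.isBounded_domain j) hξ hη

/-- Replacing the slice averages by the function itself changes the energy in the inclusions
arbitrarily little. -/
lemma IsGoodRealization.eventually_lintegral_piFun_near (h : IsGoodRealization D G place)
    {F : Space d × Fibre d N → ℝ} (j : Fin N) (hF : Continuous (component F j))
    (hF' : HasCompactSupport (component F j)) {κ : ℝ} (hκ : 0 < κ) :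
    ∀ᶠ ε in 𝓝[>] (0 : ℝ),
      ∫⁻ x in ε • copiesIn G (D j), ‖piFun D G place ε F x‖ₑ ^ 2 ≤
        (volume (D j))⁻¹ * (∫⁻ x in ε • copiesIn G (D j),
          ∫⁻ ξ in D j, ‖component F j (x, ξ)‖ₑ ^ 2) + ENNReal.ofReal κ ∧
      (volume (D j))⁻¹ * (∫⁻ x in ε • copiesIn G (D j),
          ∫⁻ ξ in D j, ‖component F j (x, ξ)‖ₑ ^ 2) ≤
        (∫⁻ x in ε • copiesIn G (D j), ‖piFun D G place ε F x‖ₑ ^ 2) + ENNReal.ofReal κ := by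
  obtain ⟨ρ, hρ⟩ := exists_forall_sliceAverage_near hF hF'
  set V := (volume (ball (0 : Space d) ρ)).toReal
  -- An error density `κ / (V + 1)` on a ball of volume `V` totals at most `κ`, also when `V = 0`.
  obtain ⟨r, hr0, hr⟩ := hρ (κ / (V + 1)) (by positivity)
  set e : Space d → ℝ≥0∞ := (ball 0 ρ).indicator fun _ => ENNReal.ofReal (κ / (V + 1))
  have he : Measurable e := measurable_const.indicator measurableSet_ball
  have hee : ∫⁻ x, e x ≤ ENNReal.ofReal κ := by
    rw [lintegral_indicator_const measurableSet_ball,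
      ← ENNReal.ofReal_toReal (measure_ball_lt_top (μ := volume) (x := (0 : Space d))
        (r := ρ)).ne, ← ENNReal.ofReal_mul (by positivity)]
    refine ENNReal.ofReal_le_ofReal ?_
    change κ / (V + 1) * V ≤ κ
    rw [div_mul_eq_mul_div, div_le_iff₀ (by positivity)]
    nlinarith [show 0 ≤ V from ENNReal.toReal_nonneg]
  have hsmall : ∀ᶠ ε in 𝓝[>] (0 : ℝ), ε * diam (D j) < r := by
    have hc : Continuous fun ε : ℝ => ε * diam (D j) := by fun_prop
    have := (hc.tendsto 0).mono_left (nhdsWithin_le_nhds (s := Ioi 0))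
    rw [zero_mul] at this
    exact this.eventually (gt_mem_nhds hr0)
  filter_upwards [hsmall, self_mem_nhdsWithin] with ε hεr hε
  replace hε : 0 < ε := hε
  have hsub : ∫⁻ x in ε • copiesIn G (D j), e x ≤ ENNReal.ofReal κ :=
    (setLIntegral_le_lintegral _ _).trans hee
  have hnear := fun C (hC : C ∈ cells G (D j)) => hr (ε • C) (h.volume_smul_cell_ne_zero hε hC)
    (h.volume_smul_cell_ne_top hε hC) (h.measurableSet_smul_cell hε hC)
    fun x hx y hy => (h.dist_le_of_mem_smul_cell hε hC hx hy).trans hεr.le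
  have hD0 := h.volume_domain_ne_zero j
  have hDt := h.volume_domain_ne_top j
  constructor
  · refine le_trans ?_ (add_le_add le_rfl hsub)
    rw [h.lintegral_smul_copiesIn hε, h.lintegral_smul_copiesIn hε, h.lintegral_smul_copiesIn hε,
      ← ENNReal.tsum_mul_left, ← ENNReal.tsum_add]
    refine ENNReal.tsum_le_tsum fun C => ?_
    rw [h.lintegral_cell_piFun hε C.2]
    exact inv_mul_lintegral_le_add (h.measurableSet_smul_cell hε C.2) hD0 hDt he
      fun x hx ξ => (hnear C C.2 x hx ξ).1
  · refine le_trans ?_ (add_le_add le_rfl hsub)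
    rw [h.lintegral_smul_copiesIn hε, h.lintegral_smul_copiesIn hε, h.lintegral_smul_copiesIn hε,
      ← ENNReal.tsum_mul_left, ← ENNReal.tsum_add]
    refine ENNReal.tsum_le_tsum fun C => ?_
    rw [h.lintegral_cell_piFun hε C.2]
    exact inv_mul_lintegral_le_add (h.measurableSet_smul_cell hε C.2) hD0 hDt he
      fun x hx ξ => (hnear C C.2 x hx ξ).2

end Convergence

/-! ### The ergodic theorem applied to the medium. -/

section Medium

variable {d N : ℕ} {Ω : Type*} [MeasurableSpace Ω] [AddAction (Space d) Ω]

lemma ae_tendsto_lintegral_vadd_mem [MeasurableVAdd₂ (Space d) Ω] (P : Measure Ω)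
    [IsProbabilityMeasure P] [ErgodicVAdd (Space d) Ω P] {A : Set Ω} (hA : MeasurableSet A)
    {g : Space d → ℝ≥0∞} (hg : AEMeasurable g) (hg' : ∫⁻ x, g x ≠ ∞) :
    ∀ᵐ ω ∂P, Tendsto (fun ε : ℝ => ∫⁻ x in {x : Space d | ε⁻¹ • x +ᵥ ω ∈ A}, g x) (𝓝[>] 0)
      (𝓝 ((∫⁻ x, g x) * P A)) := by
  have hfin := ae_lt_top' hg hg'
  filter_upwards [ae_tendsto_setIntegral_vadd_mem P hA
    (integrable_toReal_of_lintegral_ne_top hg hg')] with ω hω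
  rw [← ENNReal.tendsto_toReal_iff
    (fun ε => ((setLIntegral_le_lintegral _ _).trans_lt hg'.lt_top).ne)
    (ENNReal.mul_ne_top hg' (measure_ne_top _ _)), ENNReal.toReal_mul, ← integral_toReal hg hfin]
  refine hω.congr fun ε => ?_
  exact integral_toReal hg.restrict (ae_restrict_of_ae hfin)

variable {P : Measure Ω} {D : Fin N → Set (Space d)} {G : Ω → Set (Space d)}

lemma IsInclusionMedium.zero_mem_copiesIn_vadd (hG : IsInclusionMedium P D G) (j : Fin N)
    (x : Space d) (ω : Ω) :
    (0 : Space d) ∈ copiesIn (G (x +ᵥ ω)) (D j) ↔ x ∈ copiesIn (G ω) (D j) := by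
  rw [hG.homogeneous, zero_mem_copiesIn_translate]

lemma IsInclusionMedium.ae_isGoodRealization (hG : IsInclusionMedium P D G)
    {place : Ω → Set (Space d) → RigidMotion d} (hplace : IsPlacement P D G place) :
    ∀ᵐ ω ∂P, IsGoodRealization D (G ω) (place ω) := by
  filter_upwards [hG.components, hplace] with ω h1 h2
  refine ⟨hG.isOpen_domain, hG.isBounded_domain, fun j => ⟨0, hG.zero_mem_domain j⟩,
    hG.distinct_domains, h1, ?_⟩
  rintro j C ⟨x, hx, rfl⟩
  exact h2 j x hx

/-- By homogeneity `ε 𝒢_j` consists of the `x` for which the orbit point at `x / ε` lies in the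
event `{0 ∈ 𝒢_j}`. -/
lemma IsInclusionMedium.ae_tendsto_lintegral_copiesIn [MeasurableVAdd₂ (Space d) Ω]
    [IsProbabilityMeasure P] [ErgodicVAdd (Space d) Ω P] (hG : IsInclusionMedium P D G)
    (j : Fin N) {g : Space d → ℝ≥0∞} (hg : AEMeasurable g) (hg' : ∫⁻ x, g x ≠ ∞) :
    ∀ᵐ ω ∂P, Tendsto (fun ε : ℝ => ∫⁻ x in ε • copiesIn (G ω) (D j), g x) (𝓝[>] 0)
      (𝓝 ((∫⁻ x, g x) * P {ω | (0 : Space d) ∈ copiesIn (G ω) (D j)})) := by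
  filter_upwards [ae_tendsto_lintegral_vadd_mem P (hG.measurable_copies j) hg hg'] with ω hω
  refine hω.congr' ?_
  filter_upwards [self_mem_nhdsWithin] with ε hε
  have hset : {x : Space d | ε⁻¹ • x +ᵥ ω ∈ {ω | (0 : Space d) ∈ copiesIn (G ω) (D j)}} =
      ε • copiesIn (G ω) (D j) := by
    ext x
    rw [mem_smul_set_iff_inv_smul_mem₀ (ne_of_gt hε)]
    exact hG.zero_mem_copiesIn_vadd j _ ω
  exact congrArg (fun s => ∫⁻ x in s, g x) hset

lemma IsInclusionMedium.ae_tendsto_lintegral_compl [MeasurableVAdd₂ (Space d) Ω]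
    [IsProbabilityMeasure P] [ErgodicVAdd (Space d) Ω P] (hG : IsInclusionMedium P D G)
    {g : Space d → ℝ≥0∞} (hg : AEMeasurable g) (hg' : ∫⁻ x, g x ≠ ∞) :
    ∀ᵐ ω ∂P, Tendsto (fun ε : ℝ => ∫⁻ x in (ε • G ω)ᶜ, g x) (𝓝[>] 0)
      (𝓝 ((∫⁻ x, g x) * alphaZero P G)) := by
  filter_upwards [ae_tendsto_lintegral_vadd_mem P hG.measurable_medium.compl hg hg'] with ω hω
  refine hω.congr' ?_
  filter_upwards [self_mem_nhdsWithin] with ε hε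
  have hset : {x : Space d | ε⁻¹ • x +ᵥ ω ∈ {ω | (0 : Space d) ∈ G ω}ᶜ} = (ε • G ω)ᶜ := by
    ext x
    rw [mem_compl_iff, mem_smul_set_iff_inv_smul_mem₀ (ne_of_gt hε)]
    simp [hG.homogeneous]
  rw [hset]

end Medium

/-! ### Density of continuous compactly supported functions in `L²(E, α)`. -/

section Density

/-- Makes the σ-algebra of `E` the Borel one, so that regularity of `measureE` is meaningful. -/
instance borelSpace_sum {α β : Type*} [TopologicalSpace α] [MeasurableSpace α] [BorelSpace α]
    [TopologicalSpace β] [MeasurableSpace β] [BorelSpace β] : BorelSpace (α ⊕ β) := by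
  refine ⟨le_antisymm ?_ (MeasurableSpace.generateFrom_le fun s hs => ?_)⟩
  · intro s hs
    rw [measurableSet_sum_iff] at hs
    borelize (α ⊕ β)
    rw [← image_preimage_inl_union_image_preimage_inr s]
    exact (IsOpenEmbedding.inl.measurableEmbedding.measurableSet_image.2 hs.1).union
      (IsOpenEmbedding.inr.measurableEmbedding.measurableSet_image.2 hs.2)
  · rw [measurableSet_sum_iff]
    exact ⟨(hs.preimage continuous_inl).measurableSet, (hs.preimage continuous_inr).measurableSet⟩

instance weaklyLocallyCompactSpace_sum {α β : Type*} [TopologicalSpace α] [TopologicalSpace β]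
    [WeaklyLocallyCompactSpace α] [WeaklyLocallyCompactSpace β] :
    WeaklyLocallyCompactSpace (α ⊕ β) := by
  refine ⟨fun x => ?_⟩
  rcases x with x | x
  · obtain ⟨K, hK, hx⟩ := exists_compact_mem_nhds x
    exact ⟨Sum.inl '' K, hK.image continuous_inl, IsOpenEmbedding.inl.image_mem_nhds.2 hx⟩
  · obtain ⟨K, hK, hx⟩ := exists_compact_mem_nhds x
    exact ⟨Sum.inr '' K, hK.image continuous_inr, IsOpenEmbedding.inr.image_mem_nhds.2 hx⟩

variable {d N : ℕ} {Ω : Type*} [MeasurableSpace Ω] {P : Measure Ω}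
  {D : Fin N → Set (Space d)} {G : Ω → Set (Space d)}

/-- Closedness of the embedding is what lets compact supports pass to the components. -/
lemma isClosedEmbedding_inr_fibre (j : Fin N) :
    IsClosedEmbedding fun z : Space d × Space d =>
      ((z.1, Sum.inr (j, z.2)) : Space d × Fibre d N) := by
  have h1 : IsClosedEmbedding fun ξ : Space d => ((j, ξ) : Fin N × Space d) := by
    refine .of_continuous_injective_isClosedMap (by fun_prop) (fun _ _ h => (Prod.ext_iff.1 h).2) ?_
    intro s hs
    have : (fun ξ : Space d => ((j, ξ) : Fin N × Space d)) '' s = {j} ×ˢ s := by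
      ext ⟨i, ξ⟩
      simp [eq_comm, and_comm]
    rw [this]
    exact isClosed_singleton.prod hs
  exact IsClosedEmbedding.id.prodMap (IsClosedEmbedding.inr.comp h1)

lemma continuous_component {F : Space d × Fibre d N → ℝ} (hF : Continuous F) (j : Fin N) :
    Continuous (component F j) := hF.comp (isClosedEmbedding_inr_fibre j).continuous

lemma hasCompactSupport_component {F : Space d × Fibre d N → ℝ} (hF : HasCompactSupport F)
    (j : Fin N) : HasCompactSupport (component F j) :=
  hF.comp_isClosedEmbedding (isClosedEmbedding_inr_fibre j)

/-- The fibre measure is finite because the domains have finite volume; hence `measureE` is locally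
finite and therefore regular. -/
lemma exists_continuous_near (hα₀' : alphaZero P G ≠ ∞) (hα' : ∀ j, alpha P D G j ≠ ∞)
    (hD : ∀ j, volume (D j) ≠ ∞) (F : L2E P D G) {η : ℝ} (hη : 0 < η) :
    ∃ (g : Space d × Fibre d N → ℝ) (hg : MemLp g 2 (measureE P D G)),
      Continuous g ∧ HasCompactSupport g ∧ ‖F - hg.toLp g‖ ≤ η := by
  have : IsFiniteMeasure (fibreMeasure P D G) := by
    refine ⟨?_⟩
    rw [fibreMeasure, Measure.add_apply, Measure.finsetSum_apply]
    refine ENNReal.add_lt_top.2 ⟨?_, ENNReal.sum_lt_top.2 fun j _ => ?_⟩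
    · simpa using hα₀'.lt_top
    · rw [Measure.smul_apply, (measurableEmbedding_fibre j).map_apply]
      simpa using ENNReal.mul_lt_top (hα' j).lt_top (hD j).lt_top
  have : IsLocallyFiniteMeasure (measureE P D G) :=
    inferInstanceAs (IsLocallyFiniteMeasure (volume.prod (fibreMeasure P D G)))
  have : (measureE P D G).Regular := Measure.Regular.of_sigmaCompactSpace_of_isLocallyFiniteMeasure _
  obtain ⟨g, hgs, hle, hgc, hg⟩ := (Lp.memLp F).exists_hasCompactSupport_eLpNorm_sub_le
    ENNReal.ofNat_ne_top (ε := ENNReal.ofReal η) (by simpa using hη)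
  refine ⟨g, hg, hgc, hgs, ?_⟩
  rw [Lp.norm_def]
  refine ENNReal.toReal_le_of_le_ofReal hη.le (le_of_eq_of_le (eLpNorm_congr_ae ?_) hle)
  filter_upwards [Lp.coeFn_sub F (hg.toLp g), hg.coeFn_toLp] with z h1 h2
  rw [h1, Pi.sub_apply, Pi.sub_apply, h2]

end Density

/-! ### Convergence of the norms and conclusion. -/

section Main

variable {d N : ℕ} {Ω : Type*} [MeasurableSpace Ω] [AddAction (Space d) Ω]
  {P : Measure Ω} {D : Fin N → Set (Space d)} {G : Ω → Set (Space d)}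

/-- Convergence of the energy for continuous compactly supported functions. -/
lemma IsInclusionMedium.ae_tendsto_lintegral_piFun [MeasurableVAdd₂ (Space d) Ω]
    [IsProbabilityMeasure P] [ErgodicVAdd (Space d) Ω P] (hG : IsInclusionMedium P D G)
    {place : Ω → Set (Space d) → RigidMotion d} (hplace : IsPlacement P D G place)
    (hα₀ : alphaZero P G ≠ 0) (hα : ∀ j, alpha P D G j ≠ 0) (hα' : ∀ j, alpha P D G j ≠ ∞)
    {F : Space d × Fibre d N → ℝ} (hF : MemLp F 2 (measureE P D G)) (hFc : Continuous F)
    (hFs : HasCompactSupport F) :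
    ∀ᵐ ω ∂P, Tendsto (fun ε : ℝ => ∫⁻ x, ‖piFun D (G ω) (place ω) ε F x‖ₑ ^ 2) (𝓝[>] 0)
      (𝓝 (∫⁻ z, ‖F z‖ₑ ^ 2 ∂measureE P D G)) := by
  have hα₀' : alphaZero P G ≠ ∞ := measure_ne_top _ _
  have hF0 := memLp_inl hα₀ hα₀' hF
  have hFj := fun j => memLp_component (hα j) (hα' j) hF
  have hI0 : ∫⁻ x, ‖F (x, Sum.inl ())‖ₑ ^ 2 ≠ ∞ := by
    rw [← eLpNorm_two_sq]
    exact ENNReal.pow_ne_top hF0.2.ne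
  have hmj : ∀ j, AEMeasurable (fun z => ‖component F j z‖ₑ ^ 2)
      (volume.prod (volume.restrict (D j))) := fun j =>
    (hFj j).aestronglyMeasurable.enorm.pow_const 2
  have hprod : ∀ j, ∫⁻ z, ‖component F j z‖ₑ ^ 2 ∂(volume.prod (volume.restrict (D j))) =
      ∫⁻ x, ∫⁻ ξ in D j, ‖component F j (x, ξ)‖ₑ ^ 2 := fun j => lintegral_prod _ (hmj j)
  have hIj : ∀ j, ∫⁻ x, ∫⁻ ξ in D j, ‖component F j (x, ξ)‖ₑ ^ 2 ≠ ∞ := fun j => by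
    rw [← hprod, ← eLpNorm_two_sq]
    exact ENNReal.pow_ne_top (hFj j).2.ne
  have hcopies := ae_all_iff.2 fun j =>
    hG.ae_tendsto_lintegral_copiesIn j (hmj j).lintegral_prod_right' (hIj j)
  filter_upwards [hG.ae_isGoodRealization hplace,
    hG.ae_tendsto_lintegral_compl (hF0.aestronglyMeasurable.enorm.pow_const 2) hI0, hcopies]
    with ω h h0 hj
  have hlim : ∀ j, Tendsto (fun ε : ℝ => ∫⁻ x in ε • copiesIn (G ω) (D j),
      ‖piFun D (G ω) (place ω) ε F x‖ₑ ^ 2) (𝓝[>] 0)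
      (𝓝 (alpha P D G j * ∫⁻ x, ∫⁻ ξ in D j, ‖component F j (x, ξ)‖ₑ ^ 2)) := by
    intro j
    refine tendsto_of_eventually_le_add (ENNReal.mul_ne_top (hα' j) (hIj j)) ?_
      fun κ hκ => h.eventually_lintegral_piFun_near j (continuous_component hFc j)
        (hasCompactSupport_component hFs j) hκ
    -- The factor `|D_j|⁻¹` from the change of variables and the limiting density `P{0 ∈ 𝒢_j}`
    -- multiply to `α_j`.
    have := ENNReal.Tendsto.const_mul (a := (volume (D j))⁻¹) (hj j)
      (Or.inr (ENNReal.inv_ne_top.2 (h.volume_domain_ne_zero j)))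
    rwa [mul_comm (∫⁻ x, _), ← mul_assoc] at this
  have hsum := h0.add (tendsto_finsetSum Finset.univ fun j _ => hlim j)
  rw [lintegral_measureE, mul_comm (alphaZero P G)]
  have heq : (∑ j, alpha P D G j * ∫⁻ x, ∫⁻ ξ in D j, ‖component F j (x, ξ)‖ₑ ^ 2) =
      ∑ j, alpha P D G j *
        ∫⁻ z, ‖F (z.1, Sum.inr (j, z.2))‖ₑ ^ 2 ∂(volume.prod (volume.restrict (D j))) :=
    Finset.sum_congr rfl fun j _ => by rw [← hprod]; rfl
  rw [heq] at hsum
  refine hsum.congr' ?_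
  filter_upwards [self_mem_nhdsWithin] with ε hε
  rw [h.lintegral_eq_add_sum hε, h.lintegral_compl_piFun hε]

/-- An `ε/3` argument: the common bound `C` carries convergence from the approximants `v n` to `u`.
-/
lemma tendsto_norm_of_forall_near {E H : Type*} [NormedAddCommGroup E] [NormedAddCommGroup H]
    [NormedSpace ℝ E] [NormedSpace ℝ H] {l : Filter ℝ} {T : ℝ → E →L[ℝ] H} {C : ℝ}
    (hC : ∀ᶠ ε in l, ∀ u, ‖T ε u‖ ≤ C * ‖u‖) {u : E} {v : ℕ → E}
    (hv : ∀ n : ℕ, ‖u - v n‖ ≤ 1 / ((n : ℝ) + 1))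
    (hT : ∀ n, Tendsto (fun ε => ‖T ε (v n)‖) l (𝓝 ‖v n‖)) :
    Tendsto (fun ε => ‖T ε u‖) l (𝓝 ‖u‖) := by
  rw [Metric.tendsto_nhds]
  intro δ hδ
  obtain ⟨n, hn⟩ := exists_nat_one_div_lt (show 0 < δ / 2 / (|C| + 1) by positivity)
  have hun := ((hv n).trans hn.le)
  rw [le_div_iff₀ (by positivity)] at hun
  filter_upwards [hC, (hT n).eventually (Metric.ball_mem_nhds _ (half_pos hδ))] with ε h1 h2
  rw [Real.dist_eq] at h2 ⊢
  have h3 : |‖T ε u‖ - ‖T ε (v n)‖| ≤ |C| * ‖u - v n‖ := by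
    refine (abs_norm_sub_norm_le _ _).trans ?_
    rw [← map_sub]
    exact (h1 _).trans (by gcongr; exact le_abs_self C)
  have h4 := abs_norm_sub_norm_le u (v n)
  have h5 := abs_sub_le ‖T ε u‖ ‖T ε (v n)‖ ‖u‖
  have h6 := abs_sub_le ‖T ε (v n)‖ ‖v n‖ ‖u‖
  rw [abs_sub_comm ‖v n‖] at h6
  nlinarith

end Main

end HighContrast

open HighContrast

theorem mainTheorem7 {d N : ℕ} {Ω : Type*} [MeasurableSpace Ω] (P : Measure Ω)
    [IsProbabilityMeasure P] [AddAction (Space d) Ω] [MeasurableVAdd₂ (Space d) Ω]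
    [ErgodicVAdd (Space d) Ω P]
    (D : Fin N → Set (Space d)) (G : Ω → Set (Space d))
    (hG : IsInclusionMedium P D G)
    (hα₀ : 0 < alphaZero P G) (hα : ∀ j, 0 < alpha P D G j)
    (place : Ω → Set (Space d) → RigidMotion d) (hplace : IsPlacement P D G place) :
    ∃ π : Ω → ℝ → (L2E P D G →L[ℝ] L2 d),
      (∀ᵐ ω ∂P, ∀ ε ∈ Ioo (0 : ℝ) 1, ∀ (f : Space d × Fibre d N → ℝ)
        (hf : MemLp f 2 (measureE P D G)),
        π ω ε (hf.toLp f) =ᵐ[volume] piFun D (G ω) (place ω) ε f) ∧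
      (∃ C : ℝ, ∀ᵐ ω ∂P, ∀ ε ∈ Ioo (0 : ℝ) 1, ∀ F : L2E P D G, ‖π ω ε F‖ ≤ C * ‖F‖) ∧
      (∀ F : L2E P D G, ∀ᵐ ω ∂P,
        Tendsto (fun ε => ‖π ω ε F‖ ^ 2) (𝓝[>] 0) (𝓝 (‖F‖ ^ 2))) := by
  have hgood := hG.ae_isGoodRealization hplace
  have hD0 : ∀ j, volume (D j) ≠ 0 := fun j =>
    ((hG.isOpen_domain j).measure_pos volume ⟨0, hG.zero_mem_domain j⟩).ne'
  have hDt : ∀ j, volume (D j) ≠ ∞ := fun j => (hG.isBounded_domain j).measure_lt_top.ne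
  have hα₀' : alphaZero P G ≠ ∞ := measure_ne_top _ _
  have hα' : ∀ j, alpha P D G j ≠ ∞ := fun j =>
    ENNReal.mul_ne_top (ENNReal.inv_ne_top.2 (hD0 j)) (measure_ne_top _ _)
  -- Goodness of the realization and `0 < ε` are premises inside the existential, so that an
  -- operator can be chosen for all `ω` and `ε`; where they fail it is `0`.
  have hex : ∀ ω, ∀ ε : ℝ, ∃ T : L2E P D G →L[ℝ] L2 d,
      IsGoodRealization D (G ω) (place ω) → 0 < ε →
      (∀ (f : Space d × Fibre d N → ℝ) (hf : MemLp f 2 (measureE P D G)),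
        T (hf.toLp f) =ᵐ[volume] piFun D (G ω) (place ω) ε f) ∧
      ∀ F, ‖T F‖ ≤ √(boundSq P D G).toReal * ‖F‖ := by
    intro ω ε
    by_cases h : IsGoodRealization D (G ω) (place ω) ∧ 0 < ε
    · obtain ⟨T, hT⟩ := h.1.exists_operator hα₀.ne' hα₀' (fun j => (hα j).ne') hα' h.2
      exact ⟨T, fun _ _ => hT⟩
    · exact ⟨0, fun h1 h2 => absurd ⟨h1, h2⟩ h⟩
  choose π hπ using hex
  refine ⟨π, ?_, ⟨√(boundSq P D G).toReal, ?_⟩, fun F => ?_⟩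
  · filter_upwards [hgood] with ω hω ε hε
    exact (hπ ω ε hω hε.1).1
  · filter_upwards [hgood] with ω hω ε hε
    exact (hπ ω ε hω hε.1).2
  -- A sequence of approximants, because the null set in the convergence statement depends on the
  -- function.
  choose g hg hgc hgs hgF using fun n : ℕ => exists_continuous_near hα₀' hα' hDt F
    (η := 1 / ((n : ℝ) + 1)) (by positivity)
  have hconv := ae_all_iff.2 fun n => hG.ae_tendsto_lintegral_piFun hplace hα₀.ne'
    (fun j => (hα j).ne') hα' (hg n) (hgc n) (hgs n)
  filter_upwards [hgood, hconv] with ω hω hωn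
  refine (tendsto_norm_of_forall_near (T := π ω) (C := √(boundSq P D G).toReal)
    (v := fun n => (hg n).toLp (g n)) ?_ hgF fun n => ?_).pow 2
  · filter_upwards [self_mem_nhdsWithin] with ε hε
    exact (hπ ω ε hω hε).2
  · have hfin : ∫⁻ z, ‖g n z‖ₑ ^ 2 ∂measureE P D G ≠ ∞ := by
      rw [← eLpNorm_two_sq]
      exact ENNReal.pow_ne_top (hg n).2.ne
    have hlim := ((ENNReal.tendsto_toReal hfin).comp (hωn n)).sqrt
    have hnorm : ‖(hg n).toLp (g n)‖ = √(∫⁻ z, ‖g n z‖ₑ ^ 2 ∂measureE P D G).toReal := by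
      rw [Lp.norm_toLp, ← eLpNorm_two_sq, ENNReal.toReal_pow, Real.sqrt_sq ENNReal.toReal_nonneg]
    rw [hnorm]
    refine hlim.congr' ?_
    filter_upwards [self_mem_nhdsWithin] with ε hε
    rw [Lp.norm_def, eLpNorm_congr_ae ((hπ ω ε hω hε).1 (g n) (hg n)), Function.comp_apply,
      ← eLpNorm_two_sq, ENNReal.toReal_pow, Real.sqrt_sq ENNReal.toReal_nonneg]
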